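/- Let $p$ be a prime, let $k$ be a finite field of characteristic $p$, let $W(k)$ be its ring of $p$-typical Witt vectors, and let $n\ge 1$. For a $k$-algebra $R$ let $\sigma$ and $v$ denote the Frobenius and the Verschiebung of Witt vectors, let $W_n(R)$ be the ring of Witt vectors of length $n$, and let $I_{n+1}(R)=\ker(W_{n+1}(R)\to R)=\{v(a)\mid a\in W_n(R)\}$. Let $\underline{W}_n(R)=\bigoplus_{i\in\mathbb{Z}}S_i$ be the $\mathbb{Z}$-graded ring of the truncated Witt frame: $\bigoplus_{i\le 0}S_i=W_n(R)[t]$ is a polynomial ring with $\deg t=-1$, and $S_i=I_{n+1}(R)$ for $i\ge 1$. The product $S_0\times S_i\to S_i$ is the module structure $a\cdot v(b)=v(\sigma(a)b)$ for $i\ge 1$, the product $S_i\times S_j\to S_{i+j}$ is $(v(a),v(b))\mapsto v(ab)$ for $i,j\ge 1$, multiplication by $t$ is the natural map $I_{n+1}(R)\to W_n(R)$ on $S_1$, and it is multiplication by $p$ as a map $S_{i+1}\to S_i$ for $i\ge 1$. This is a graded $W(k)$-algebra via $W(k)\to W_n(R)=S_0$, functorial in $R$, and truncation of Witt vectors gives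 homomorphisms of graded $W(k)$-algebras $\underline{W}_{n+1}(R)\to\underline{W}_n(R)$. Let $X=\operatorname{Spec}A$ be an affine $W(k)$-scheme of finite type with an action of $\mathbb{G}_m$, i.e. with a $\mathbb{Z}$-grading of the $W(k)$-algebra $A$. For a $k$-algebra $R$ let $X_n(R)=X(\underline{W}_n(R))^0$ be the set of homomorphisms of graded $W(k)$-algebras $A\to\underline{W}_n(R)$. Then the functor $X_n$ on $k$-algebras is representable by an affine $k$-scheme of finite type. If $X$ is smooth over $W(k)$ of relative dimension $d$, then $X_n$ is smooth over $k$ of relative dimension $nd$, and the reduction map $X_{n+1}\to X_n$ is surjective and smooth of relative dimension $d$. -/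

import Mathlib

open CategoryTheory AlgebraicGeometry

universe u

/-! ### Frobenius and Verschiebung on truncated Witt vectors of an `𝔽_p`-algebra -/

namespace TruncWitt

variable {p : ℕ} [Fact p.Prime] {n : ℕ} {R : Type*} [CommRing R]

theorem truncate_frobenius_congr (hp : (p : R) = 0) {x y : WittVector p R}
    (h : WittVector.truncate n x = WittVector.truncate n y) :
    WittVector.truncate n (WittVector.frobenius x) =
      WittVector.truncate n (WittVector.frobenius y) := by
  rcases subsingleton_or_nontrivial R with hR | hR
  · exact TruncatedWittVector.ext fun i => Subsingleton.elim _ _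
  · have : CharP R p := (CharP.charP_iff_prime_eq_zero Fact.out).2 hp
    refine TruncatedWittVector.ext fun i => ?_
    have hi := congrArg (TruncatedWittVector.coeff i) h
    rw [WittVector.coeff_truncate, WittVector.coeff_truncate] at hi
    rw [WittVector.coeff_truncate, WittVector.coeff_truncate,
      WittVector.coeff_frobenius_charP, WittVector.coeff_frobenius_charP, hi]

theorem truncate_verschiebung_congr {x y : WittVector p R}
    (h : WittVector.truncate n x = WittVector.truncate n y) :
    WittVector.truncate n (WittVector.verschiebung x) =
      WittVector.truncate n (WittVector.verschiebung y) := by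
  refine TruncatedWittVector.ext fun i => ?_
  obtain ⟨i, hi⟩ := i
  rw [WittVector.coeff_truncate, WittVector.coeff_truncate]
  cases i with
  | zero => simp
  | succ j =>
    have hj := congrArg (TruncatedWittVector.coeff ⟨j, by omega⟩) h
    rw [WittVector.coeff_truncate, WittVector.coeff_truncate] at hj
    simpa using hj

theorem truncate_out (x : TruncatedWittVector p n R) : WittVector.truncate n x.out = x :=
  TruncatedWittVector.truncateFun_out x

/-- The Verschiebung `v : W_n(R) → W_n(R)`, induced by that of `W(R)`. -/
noncomputable def versch : TruncatedWittVector p n R →+ TruncatedWittVector p n R where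
  toFun x := WittVector.truncate n (WittVector.verschiebung x.out)
  map_zero' := by
    rw [truncate_verschiebung_congr (y := 0) (by rw [truncate_out, map_zero]), map_zero, map_zero]
  map_add' x y := by
    rw [← map_add, ← map_add]
    exact truncate_verschiebung_congr (by rw [map_add, truncate_out, truncate_out, truncate_out])

theorem versch_truncate (x : WittVector p R) :
    versch (WittVector.truncate n x) = WittVector.truncate n (WittVector.verschiebung x) :=
  truncate_verschiebung_congr (truncate_out _)

/-- The Frobenius `σ : W_n(R) → W_n(R)`, induced by that of `W(R)`; here `p = 0` in `R`. -/
noncomputable def frob (hp : (p : R) = 0) :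
    TruncatedWittVector p n R →+* TruncatedWittVector p n R where
  toFun x := WittVector.truncate n (WittVector.frobenius x.out)
  map_zero' := by
    rw [truncate_frobenius_congr hp (y := 0) (by rw [truncate_out, map_zero]), map_zero, map_zero]
  map_one' := by
    rw [truncate_frobenius_congr hp (y := 1) (by rw [truncate_out, map_one]), map_one, map_one]
  map_add' x y := by
    rw [← map_add, ← map_add]
    exact truncate_frobenius_congr hp (by rw [map_add, truncate_out, truncate_out, truncate_out])
  map_mul' x y := by
    rw [← map_mul, ← map_mul]
    exact truncate_frobenius_congr hp (by rw [map_mul, truncate_out, truncate_out, truncate_out])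

theorem frob_truncate (hp : (p : R) = 0) (x : WittVector p R) :
    frob hp (WittVector.truncate n x) = WittVector.truncate n (WittVector.frobenius x) :=
  truncate_frobenius_congr hp (truncate_out _)

theorem frob_versch (hp : (p : R) = 0) (x : TruncatedWittVector p n R) :
    frob hp (versch x) = (p : TruncatedWittVector p n R) * x := by
  obtain ⟨x, rfl⟩ := WittVector.truncate_surjective p n R x
  rw [versch_truncate, frob_truncate, WittVector.frobenius_verschiebung, map_mul, map_natCast,
    mul_comm]

theorem versch_frob_mul (hp : (p : R) = 0) (x y : TruncatedWittVector p n R) :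
    versch (frob hp x * y) = x * versch y := by
  obtain ⟨x, rfl⟩ := WittVector.truncate_surjective p n R x
  obtain ⟨y, rfl⟩ := WittVector.truncate_surjective p n R y
  rw [versch_truncate, frob_truncate, ← map_mul, versch_truncate, ← map_mul, mul_comm,
    WittVector.verschiebung_mul_frobenius, mul_comm]

/-- The ring homomorphism `W_n(R) → W_n(R')` induced by a ring homomorphism `R → R'`. -/
noncomputable def map {R' : Type*} [CommRing R'] (f : R →+* R') :
    TruncatedWittVector p n R →+* TruncatedWittVector p n R' :=
  RingHom.liftOfRightInverse (WittVector.truncate n) TruncatedWittVector.out truncate_out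
    ⟨(WittVector.truncate n).comp (WittVector.map f), fun x hx => by
      rw [WittVector.mem_ker_truncate] at hx
      rw [RingHom.mem_ker, RingHom.comp_apply, ← RingHom.mem_ker, WittVector.mem_ker_truncate]
      intro i hi
      rw [WittVector.map_coeff, hx i hi, map_zero]⟩

theorem map_truncate {R' : Type*} [CommRing R'] (f : R →+* R') (x : WittVector p R) :
    map f (WittVector.truncate n x) = WittVector.truncate n (WittVector.map f x) :=
  RingHom.liftOfRightInverse_comp_apply _ _ _ _ x

theorem map_versch {R' : Type*} [CommRing R'] (f : R →+* R') (x : TruncatedWittVector p n R) :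
    map f (versch x) = versch (map f x) := by
  obtain ⟨x, rfl⟩ := WittVector.truncate_surjective p n R x
  rw [versch_truncate, map_truncate, map_truncate, versch_truncate, WittVector.map_verschiebung]

theorem map_frob {R' : Type*} [CommRing R'] (hp : (p : R) = 0) (hp' : (p : R') = 0)
    (f : R →+* R') (x : TruncatedWittVector p n R) :
    map f (frob hp x) = frob hp' (map f x) := by
  obtain ⟨x, rfl⟩ := WittVector.truncate_surjective p n R x
  rw [frob_truncate, map_truncate, map_truncate, frob_truncate]
  rcases subsingleton_or_nontrivial R' with hR | hR
  · exact TruncatedWittVector.ext fun i => Subsingleton.elim _ _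
  · have := f.domain_nontrivial
    have : CharP R p := (CharP.charP_iff_prime_eq_zero Fact.out).2 hp
    have : CharP R' p := (CharP.charP_iff_prime_eq_zero Fact.out).2 hp'
    refine congrArg _ (WittVector.ext fun i => ?_)
    rw [WittVector.map_coeff, WittVector.coeff_frobenius_charP, WittVector.coeff_frobenius_charP,
      WittVector.map_coeff, map_pow]

theorem map_id (x : TruncatedWittVector p n R) : map (RingHom.id R) x = x := by
  obtain ⟨x, rfl⟩ := WittVector.truncate_surjective p n R x
  rw [map_truncate, WittVector.map_id, RingHom.id_apply]

theorem map_map {R' R'' : Type*} [CommRing R'] [CommRing R''] (f : R →+* R') (g : R' →+* R'')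
    (x : TruncatedWittVector p n R) : map g (map f x) = map (g.comp f) x := by
  obtain ⟨x, rfl⟩ := WittVector.truncate_surjective p n R x
  rw [map_truncate, map_truncate, map_truncate]
  congr 1

theorem truncate_versch {m : ℕ} (h : n ≤ m) (x : TruncatedWittVector p m R) :
    TruncatedWittVector.truncate h (versch x) = versch (TruncatedWittVector.truncate h x) := by
  obtain ⟨x, rfl⟩ := WittVector.truncate_surjective p m R x
  rw [versch_truncate, TruncatedWittVector.truncate_wittVector_truncate,
    TruncatedWittVector.truncate_wittVector_truncate, versch_truncate]

theorem truncate_frob {m : ℕ} (h : n ≤ m) (hp : (p : R) = 0) (x : TruncatedWittVector p m R) :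
    TruncatedWittVector.truncate h (frob hp x) = frob hp (TruncatedWittVector.truncate h x) := by
  obtain ⟨x, rfl⟩ := WittVector.truncate_surjective p m R x
  rw [frob_truncate, TruncatedWittVector.truncate_wittVector_truncate,
    TruncatedWittVector.truncate_wittVector_truncate, frob_truncate]

theorem truncate_map {m : ℕ} (h : n ≤ m) {R' : Type*} [CommRing R'] (f : R →+* R')
    (x : TruncatedWittVector p m R) :
    TruncatedWittVector.truncate h (map f x) = map f (TruncatedWittVector.truncate h x) := by
  obtain ⟨x, rfl⟩ := WittVector.truncate_surjective p m R x
  rw [map_truncate, TruncatedWittVector.truncate_wittVector_truncate,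
    TruncatedWittVector.truncate_wittVector_truncate, map_truncate]

end TruncWitt

/-! ### The graded ring of the truncated Witt frame -/

namespace TruncWittFrame

section

variable {p : ℕ} [Fact p.Prime] {n : ℕ} {R : Type*} [CommRing R]

/-- The degree `i` component `τ_i : S_i → S_0 = W_n(R)` of the homomorphism `τ`:
the identity `t^{-i} a ↦ a` for `i ≤ 0`, and `v(a) ↦ p^{i-1} v(a)` for `i ≥ 1`. -/
noncomputable def tau (i : ℤ) : TruncatedWittVector p n R →+ TruncatedWittVector p n R :=
  if i ≤ 0 then AddMonoidHom.id _ else (p ^ (i - 1).toNat) • TruncWitt.versch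

/-- The degree `i` component `σ_i : S_i → S_0 = W_n(R)` of the homomorphism `σ`:
`t^{-i} a ↦ p^{-i} σ(a)` for `i ≤ 0`, and `v(a) ↦ a` for `i ≥ 1`. -/
noncomputable def sigma (hp : (p : R) = 0) (i : ℤ) :
    TruncatedWittVector p n R →+ TruncatedWittVector p n R :=
  if i ≤ 0 then (p ^ (-i).toNat) • (TruncWitt.frob hp).toAddMonoidHom else AddMonoidHom.id _

/-- The product `S_i × S_j → S_{i+j}`. Since `τ` is the identity in degrees `≤ 0` and `σ` is the
identity in degrees `≥ 1`, it is determined by the multiplicativity of `τ` and `σ`. -/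
noncomputable def mul (hp : (p : R) = 0) (i j : ℤ) (a b : TruncatedWittVector p n R) :
    TruncatedWittVector p n R :=
  if i + j ≤ 0 then tau i a * tau j b else sigma hp i a * sigma hp j b

theorem tau_nonpos {i : ℤ} (h : i ≤ 0) (a : TruncatedWittVector p n R) : tau i a = a := by
  simp [tau, h]

theorem tau_pos {i : ℤ} (h : 0 < i) (a : TruncatedWittVector p n R) :
    tau i a = (p : TruncatedWittVector p n R) ^ (i - 1).toNat * TruncWitt.versch a := by
  simp [tau, not_le.2 h, nsmul_eq_mul]

theorem sigma_nonpos (hp : (p : R) = 0) {i : ℤ} (h : i ≤ 0) (a : TruncatedWittVector p n R) :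
    sigma hp i a = (p : TruncatedWittVector p n R) ^ (-i).toNat * TruncWitt.frob hp a := by
  simp [sigma, h, nsmul_eq_mul]

theorem sigma_pos (hp : (p : R) = 0) {i : ℤ} (h : 0 < i) (a : TruncatedWittVector p n R) :
    sigma hp i a = a := by
  simp [sigma, not_le.2 h]

theorem versch_natCast_pow_mul (m : ℕ) (a : TruncatedWittVector p n R) :
    TruncWitt.versch ((p : TruncatedWittVector p n R) ^ m * a) =
      (p : TruncatedWittVector p n R) ^ m * TruncWitt.versch a := by
  have h := map_nsmul (TruncWitt.versch (p := p) (n := n) (R := R)) (p ^ m) a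
  simpa [nsmul_eq_mul] using h

theorem mul_comm' (hp : (p : R) = 0) (i j : ℤ) (a b : TruncatedWittVector p n R) :
    mul hp i j a b = mul hp j i b a := by
  unfold mul
  rw [add_comm j i, mul_comm (tau j b), mul_comm (sigma hp j b)]

theorem mul_add' (hp : (p : R) = 0) (i j : ℤ) (a b c : TruncatedWittVector p n R) :
    mul hp i j a (b + c) = mul hp i j a b + mul hp i j a c := by
  unfold mul
  split_ifs <;> rw [map_add, mul_add]

theorem mul_zero' (hp : (p : R) = 0) (i j : ℤ) (a : TruncatedWittVector p n R) :
    mul hp i j a 0 = 0 := by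
  simp [mul]

theorem tau_mul (hp : (p : R) = 0) (i j : ℤ) (a b : TruncatedWittVector p n R) :
    tau (i + j) (mul hp i j a b) = tau i a * tau j b := by
  rcases le_or_gt (i + j) 0 with h | h
  · rw [tau_nonpos h, mul, if_pos h]
  · wlog hij : i ≤ j generalizing i j a b
    · rw [mul_comm' hp, add_comm i j, mul_comm (tau i a)]
      exact this j i b a (by omega) (by omega)
    rw [tau_pos h, mul, if_neg (not_le.2 h)]
    have hj : 0 < j := by omega
    rw [sigma_pos hp hj, tau_pos hj]
    rcases le_or_gt i 0 with hi | hi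
    · rw [sigma_nonpos hp hi, tau_nonpos hi, mul_assoc, versch_natCast_pow_mul,
        TruncWitt.versch_frob_mul, ← mul_assoc, ← pow_add,
        show (i + j - 1).toNat + (-i).toNat = (j - 1).toNat by omega]
      ring
    · rw [sigma_pos hp hi, tau_pos hi,
        show (i + j - 1).toNat = (i - 1).toNat + (j - 1).toNat + 1 by omega]
      have h2 : TruncWitt.versch a * TruncWitt.versch b =
          (p : TruncatedWittVector p n R) * TruncWitt.versch (a * b) := by
        rw [← TruncWitt.versch_frob_mul hp, TruncWitt.frob_versch, mul_assoc]
        simpa using versch_natCast_pow_mul 1 (a * b)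
      calc _ = (p : TruncatedWittVector p n R) ^ ((i - 1).toNat + (j - 1).toNat) *
            ((p : TruncatedWittVector p n R) * TruncWitt.versch (a * b)) := by ring
        _ = _ := by rw [← h2]; ring

theorem sigma_mul (hp : (p : R) = 0) (i j : ℤ) (a b : TruncatedWittVector p n R) :
    sigma hp (i + j) (mul hp i j a b) = sigma hp i a * sigma hp j b := by
  rcases le_or_gt (i + j) 0 with h | h
  · wlog hij : i ≤ j generalizing i j a b
    · rw [mul_comm' hp, add_comm i j, mul_comm (sigma hp i a)]
      exact this j i b a (by omega) (by omega)
    have hi : i ≤ 0 := by omega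
    rw [sigma_nonpos hp h, mul, if_pos h, tau_nonpos hi, map_mul, sigma_nonpos hp hi]
    rcases le_or_gt j 0 with hj | hj
    · rw [sigma_nonpos hp hj, tau_nonpos hj,
        show (-(i + j)).toNat = (-i).toNat + (-j).toNat by omega]
      ring
    · rw [sigma_pos hp hj, tau_pos hj, map_mul, map_pow, map_natCast, TruncWitt.frob_versch,
        show (-i).toNat = (-(i + j)).toNat + (j - 1).toNat + 1 by omega]
      ring
  · rw [sigma_pos hp h, mul, if_neg (not_le.2 h)]

theorem ext_tau_sigma (hp : (p : R) = 0) (i : ℤ) {a b : TruncatedWittVector p n R}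
    (ht : tau i a = tau i b) (hs : sigma hp i a = sigma hp i b) : a = b := by
  rcases le_or_gt i 0 with h | h
  · rwa [tau_nonpos h, tau_nonpos h] at ht
  · rwa [sigma_pos hp h, sigma_pos hp h] at hs

end

/-- The degree `i` component `S_i` of the truncated Witt frame of the `k`-algebra `R`, where `k`
has characteristic `p`, written in the coordinate `a ∈ W_n(R)`: for `i ≤ 0` the element `a` stands
for `t^{-i} a ∈ S_i = t^{-i} W_n(R)`, and for `i ≥ 1` it stands for the element `v(a)` of
`S_i = I_{n+1}(R)`, where `v : W_n(R) ≃ I_{n+1}(R) = ker (W_{n+1}(R) → R)`. -/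
def Piece (p n : ℕ) (_k R : Type*) (_i : ℤ) : Type _ := TruncatedWittVector p n R

theorem natCast_eq_zero (p : ℕ) (k R : Type*) [Field k] [CharP k p] [CommRing R] [Algebra k R] :
    (p : R) = 0 := by
  rw [← map_natCast (algebraMap k R), CharP.cast_eq_zero, map_zero]

theorem mk_eq_mk {p n : ℕ} {k R : Type*} {i j : ℤ} (h : i = j) {a : Piece p n k R i}
    {b : Piece p n k R j} (hab : (show TruncatedWittVector p n R from a) = b) :
    GradedMonoid.mk i a = GradedMonoid.mk j b := by
  subst h
  exact congrArg _ hab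

section

variable {p : ℕ} [Fact p.Prime] {n : ℕ} {k R : Type*} [Field k] [CharP k p] [CommRing R]
  [Algebra k R]

noncomputable instance (i : ℤ) : AddCommGroup (Piece p n k R i) :=
  inferInstanceAs (AddCommGroup (TruncatedWittVector p n R))

/-- The unit `1 ∈ S_0 = W_n(R)`. -/
noncomputable instance instGOne : GradedMonoid.GOne (Piece p n k R) where
  one := (1 : TruncatedWittVector p n R)

/-- The product of `a ∈ S_i` and `b ∈ S_j` is `mul i j a b`. Explicitly,
it is `ab` if `i, j ≤ 0`, it is `v(a) v(b) := v(ab)` if `i, j ≥ 1`, and for `m ≥ 0`, `j ≥ 1` the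
multiplication by `t^m a` on `S_j` is multiplication by `a` after `t^m`, where `t : S_1 → S_0` is the natural map
`I_{n+1}(R) → W_n(R)` and `t : S_{j+1} → S_j` is multiplication by `p` for `j ≥ 1`. -/
noncomputable instance instGMul : GradedMonoid.GMul (Piece p n k R) where
  mul {i j} a b := mul (natCast_eq_zero p k R) i j a b

/-- The graded ring structure on the family `S_i`. -/
noncomputable instance : DirectSum.GCommRing (Piece p n k R) where
  mul_zero {i j} a := mul_zero' _ i j a
  zero_mul {i j} b := (mul_comm' _ i j 0 b).trans (mul_zero' _ j i b)
  mul_add {i j} a b c := mul_add' _ i j a b c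
  add_mul {i j} a b c := (mul_comm' _ i j _ c).trans ((mul_add' _ j i c a b).trans
    (congrArg₂ _ (mul_comm' _ j i c a) (mul_comm' _ j i c b)))
  one_mul a := by
    refine mk_eq_mk (zero_add _) (ext_tau_sigma (natCast_eq_zero p k R) a.1 ?_ ?_)
    · have h := tau_mul (natCast_eq_zero p k R) 0 a.1 1 a.2
      rwa [tau_nonpos le_rfl, _root_.one_mul, zero_add] at h
    · have h := sigma_mul (natCast_eq_zero p k R) 0 a.1 1 a.2
      rw [sigma_nonpos _ le_rfl, map_one, _root_.mul_one, neg_zero, Int.toNat_zero, pow_zero,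
        _root_.one_mul, zero_add] at h
      exact h
  mul_one a := by
    refine mk_eq_mk (add_zero _) (ext_tau_sigma (natCast_eq_zero p k R) a.1 ?_ ?_)
    · have h := tau_mul (natCast_eq_zero p k R) a.1 0 a.2 1
      rwa [tau_nonpos le_rfl, _root_.mul_one, add_zero] at h
    · have h := sigma_mul (natCast_eq_zero p k R) a.1 0 a.2 1
      rw [sigma_nonpos _ le_rfl, map_one, _root_.mul_one, neg_zero, Int.toNat_zero, pow_zero,
        _root_.mul_one, add_zero] at h
      exact h
  mul_assoc a b c := by
    refine mk_eq_mk (add_assoc _ _ _)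
      (ext_tau_sigma (natCast_eq_zero p k R) (a.1 + b.1 + c.1) ?_ ?_)
    · refine (tau_mul _ (a.1 + b.1) c.1 _ c.2).trans ?_
      rw [add_assoc]
      refine Eq.trans ?_ (tau_mul _ a.1 (b.1 + c.1) a.2 _).symm
      exact (congrArg (· * _) (tau_mul _ a.1 b.1 a.2 b.2)).trans
        ((_root_.mul_assoc _ _ _).trans (congrArg (_ * ·) (tau_mul _ b.1 c.1 b.2 c.2).symm))
    · refine (sigma_mul _ (a.1 + b.1) c.1 _ c.2).trans ?_
      rw [add_assoc]
      refine Eq.trans ?_ (sigma_mul _ a.1 (b.1 + c.1) a.2 _).symm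
      exact (congrArg (· * _) (sigma_mul _ a.1 b.1 a.2 b.2)).trans
        ((_root_.mul_assoc _ _ _).trans (congrArg (_ * ·) (sigma_mul _ b.1 c.1 b.2 c.2).symm))
  mul_comm a b := mk_eq_mk (add_comm _ _) (mul_comm' _ a.1 b.1 a.2 b.2)
  natCast m := (m : TruncatedWittVector p n R)
  natCast_zero := Nat.cast_zero (R := TruncatedWittVector p n R)
  natCast_succ m := Nat.cast_succ (R := TruncatedWittVector p n R) m
  intCast m := (m : TruncatedWittVector p n R)
  intCast_ofNat m := Int.cast_natCast (R := TruncatedWittVector p n R) m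
  intCast_negSucc_ofNat m := Int.cast_negSucc (R := TruncatedWittVector p n R) m

end

end TruncWittFrame

open DirectSum in
/-- The `ℤ`-graded ring `S = ⨁ S_i` of the truncated Witt frame of level `n` of a `k`-algebra
`R`, for a field `k` of characteristic `p`. -/
abbrev TruncWittFrame (p n : ℕ) [Fact p.Prime] (k R : Type*) [Field k] [CharP k p] [CommRing R]
    [Algebra k R] : Type _ :=
  ⨁ i : ℤ, TruncWittFrame.Piece p n k R i

namespace TruncWittFrame

variable {p : ℕ} [Fact p.Prime] {n : ℕ} {k : Type*} [Field k] [CharP k p]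

/-- The inclusion of the homogeneous component `S_i` in `S`. -/
noncomputable def incl (p n : ℕ) [Fact p.Prime] (k R : Type*) [Field k] [CharP k p] [CommRing R]
    [Algebra k R] (i : ℤ) : TruncatedWittVector p n R →+ TruncWittFrame p n k R :=
  DirectSum.of (Piece p n k R) i

theorem incl_mul_incl {R : Type*} [CommRing R] [Algebra k R] (i j : ℤ)
    (a b : TruncatedWittVector p n R) :
    incl p n k R i a * incl p n k R j b =
      incl p n k R (i + j) (mul (natCast_eq_zero p k R) i j a b) :=
  DirectSum.of_mul_of (A := Piece p n k R) a b

/-- The ring homomorphism `W_n(R) = S_0 → S`. -/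
noncomputable def inclZero (p n : ℕ) [Fact p.Prime] (k R : Type*) [Field k] [CharP k p]
    [CommRing R] [Algebra k R] : TruncatedWittVector p n R →+* TruncWittFrame p n k R where
  __ := incl p n k R 0
  map_one' := rfl
  map_mul' a b := by
    refine Eq.trans ?_ (incl_mul_incl (k := k) 0 0 a b).symm
    rw [mul, add_zero, if_pos le_rfl, tau_nonpos le_rfl, tau_nonpos le_rfl]
    rfl

/-- `S` as a `W(k)`-algebra, via `W(k) → W(R) → W_n(R) = S_0`. -/
noncomputable instance {R : Type*} [CommRing R] [Algebra k R] :
    Algebra (WittVector p k) (TruncWittFrame p n k R) :=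
  ((inclZero p n k R).comp
    ((WittVector.truncate n).comp (WittVector.map (algebraMap k R)))).toAlgebra

/-- A ring homomorphism `W_n(R) → W_m(R')` that commutes with `σ` and `v` induces a homomorphism
of graded rings, given by it in all coordinates. -/
noncomputable def mapRingHom {m : ℕ} {R R' : Type*} [CommRing R] [Algebra k R] [CommRing R']
    [Algebra k R'] (f : TruncatedWittVector p n R →+* TruncatedWittVector p m R')
    (hV : ∀ x, f (TruncWitt.versch x) = TruncWitt.versch (f x))
    (hF : ∀ x, f (TruncWitt.frob (natCast_eq_zero p k R) x) =
      TruncWitt.frob (natCast_eq_zero p k R') (f x)) :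
    TruncWittFrame p n k R →+* TruncWittFrame p m k R' :=
  DirectSum.toSemiring (fun i => (incl p m k R' i).comp f.toAddMonoidHom)
    (by
      change inclZero p m k R' (f 1) = 1
      rw [map_one, map_one])
    (by
      intro i j a b
      have ht : ∀ (i : ℤ) (x : TruncatedWittVector p n R), f (tau i x) = tau i (f x) := by
        intro i x
        rcases le_or_gt i 0 with h | h
        · rw [tau_nonpos h, tau_nonpos h]
        · rw [tau_pos h, tau_pos h, map_mul, map_pow, map_natCast, hV]
      have hs : ∀ (i : ℤ) (x : TruncatedWittVector p n R),
          f (sigma (natCast_eq_zero p k R) i x) = sigma (natCast_eq_zero p k R') i (f x) := by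
        intro i x
        rcases le_or_gt i 0 with h | h
        · rw [sigma_nonpos _ h, sigma_nonpos _ h, map_mul, map_pow, map_natCast, hF]
        · rw [sigma_pos _ h, sigma_pos _ h]
      refine Eq.trans ?_ (incl_mul_incl (k := k) i j (f a) (f b)).symm
      change incl p m k R' (i + j) (f (mul _ i j a b)) = _
      refine congrArg _ ?_
      unfold mul
      split_ifs
      · exact (map_mul f _ _).trans (congrArg₂ _ (ht i a) (ht j b))
      · exact (map_mul f _ _).trans (congrArg₂ _ (hs i a) (hs j b)))

theorem mapRingHom_incl {m : ℕ} {R R' : Type*} [CommRing R] [Algebra k R] [CommRing R']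
    [Algebra k R'] (f : TruncatedWittVector p n R →+* TruncatedWittVector p m R')
    (hV : ∀ x, f (TruncWitt.versch x) = TruncWitt.versch (f x))
    (hF : ∀ x, f (TruncWitt.frob (natCast_eq_zero p k R) x) =
      TruncWitt.frob (natCast_eq_zero p k R') (f x)) (i : ℤ) (a : TruncatedWittVector p n R) :
    mapRingHom (k := k) f hV hF (incl p n k R i a) = incl p m k R' i (f a) :=
  DirectSum.toAddMonoid_of (β := Piece p n k R)
    (fun i => (incl p m k R' i).comp f.toAddMonoidHom) i a

/-- The homomorphism of graded `W(k)`-algebras induced by a homomorphism of `k`-algebras. -/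
noncomputable def map {R R' : Type*} [CommRing R] [Algebra k R] [CommRing R'] [Algebra k R']
    (f : R →ₐ[k] R') : TruncWittFrame p n k R →ₐ[WittVector p k] TruncWittFrame p n k R' where
  __ := mapRingHom (TruncWitt.map f.toRingHom) (TruncWitt.map_versch _) (TruncWitt.map_frob _ _ _)
  commutes' x := by
    refine (mapRingHom_incl _ _ _ 0 _).trans (congrArg (incl p n k R' 0) ?_)
    rw [RingHom.comp_apply, TruncWitt.map_truncate, RingHom.comp_apply]
    refine congrArg (WittVector.truncate (p := p) (R := R') n) (WittVector.ext fun i => ?_)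
    simp [WittVector.map_coeff]

theorem map_incl {R R' : Type*} [CommRing R] [Algebra k R] [CommRing R'] [Algebra k R']
    (f : R →ₐ[k] R') (i : ℤ) (a : TruncatedWittVector p n R) :
    map f (incl p n k R i a) = incl p n k R' i (TruncWitt.map f.toRingHom a) :=
  mapRingHom_incl (TruncWitt.map f.toRingHom) (TruncWitt.map_versch _) (TruncWitt.map_frob _ _ _)
    i a

/-- The reduction from level `m` to level `n ≤ m`. -/
noncomputable def reduction {m : ℕ} (h : n ≤ m) (R : Type*) [CommRing R] [Algebra k R] :
    TruncWittFrame p m k R →ₐ[WittVector p k] TruncWittFrame p n k R where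
  __ := mapRingHom (TruncatedWittVector.truncate h) (TruncWitt.truncate_versch h)
    (TruncWitt.truncate_frob h _)
  commutes' x := by
    refine (mapRingHom_incl _ _ _ 0 _).trans (congrArg (incl p n k R 0) ?_)
    rw [RingHom.comp_apply, TruncatedWittVector.truncate_wittVector_truncate]
    rfl

theorem reduction_incl {m : ℕ} (h : n ≤ m) {R : Type*} [CommRing R] [Algebra k R] (i : ℤ)
    (a : TruncatedWittVector p m R) :
    reduction h R (incl p m k R i a) = incl p n k R i (TruncatedWittVector.truncate h a) :=
  mapRingHom_incl (TruncatedWittVector.truncate h) (TruncWitt.truncate_versch h)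
    (TruncWitt.truncate_frob h _) i a

theorem induction_incl {R : Type*} [CommRing R] [Algebra k R]
    {T : Type*} [AddCommMonoid T] {f g : TruncWittFrame p n k R →+ T}
    (h : ∀ i a, f (incl p n k R i a) = g (incl p n k R i a)) : f = g :=
  DirectSum.addHom_ext h

theorem map_id (R : Type*) [CommRing R] [Algebra k R] (x : TruncWittFrame p n k R) :
    map (AlgHom.id k R) x = x := by
  refine DFunLike.congr_fun (f := (map (n := n) (p := p) (AlgHom.id k R)).toRingHom.toAddMonoidHom)
    (g := AddMonoidHom.id _) (induction_incl fun i a => ?_) x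
  exact (map_incl _ i a).trans (congrArg _ (TruncWitt.map_id a))

theorem map_map {R R' R'' : Type*} [CommRing R] [Algebra k R] [CommRing R'] [Algebra k R']
    [CommRing R''] [Algebra k R''] (f : R →ₐ[k] R') (g : R' →ₐ[k] R'')
    (x : TruncWittFrame p n k R) : map g (map f x) = map (g.comp f) x := by
  refine DFunLike.congr_fun
    (f := ((map (n := n) (p := p) g).comp (map f)).toRingHom.toAddMonoidHom)
    (g := (map (n := n) (p := p) (g.comp f)).toRingHom.toAddMonoidHom)
    (induction_incl fun i a => ?_) x
  change map g (map f (incl p n k R i a)) = map (g.comp f) (incl p n k R i a)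
  rw [map_incl, map_incl, map_incl, TruncWitt.map_map]
  rfl

theorem reduction_map {m : ℕ} (h : n ≤ m) {R R' : Type*} [CommRing R] [Algebra k R] [CommRing R']
    [Algebra k R'] (f : R →ₐ[k] R') (x : TruncWittFrame p m k R) :
    reduction h R' (map f x) = map f (reduction h R x) := by
  refine DFunLike.congr_fun
    (f := ((reduction h R').comp (map (n := m) (p := p) f)).toRingHom.toAddMonoidHom)
    (g := ((map (n := n) (p := p) f).comp (reduction h R)).toRingHom.toAddMonoidHom)
    (induction_incl fun i a => ?_) x
  change reduction h R' (map f (incl p m k R i a)) = map f (reduction h R (incl p m k R i a))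
  rw [map_incl, reduction_incl, reduction_incl, map_incl, TruncWitt.truncate_map]

end TruncWittFrame

/-! ### Graded points -/

section GradedPoints

variable (p : ℕ) [Fact p.Prime] {k : Type u} [Field k] [CharP k p] {A : Type u} [CommRing A]
  [Algebra (WittVector p k) A] (𝒜 : ℤ → Submodule (WittVector p k) A)

/-- The set `X(S)^0` of graded points of `X = Spec A`, where the `𝔾_m`-action on `X` is given by the
grading `𝒜` of `A`, in the truncated Witt frame `S` of level `n` of `R`: the homomorphisms of graded
`W(k)`-algebras `A → S`. -/
def GradedPoints (n : ℕ) (R : Type u) [CommRing R] [Algebra k R] : Type u :=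
  {f : A →ₐ[WittVector p k] TruncWittFrame p n k R //
    ∀ i, ∀ a ∈ 𝒜 i, f a ∈ (TruncWittFrame.incl p n k R i).range}

/-- The functor `X_n : R ↦ X(S)^0` on the category of `k`-algebras. -/
noncomputable def gradedPointsFunctor (n : ℕ) : CommAlgCat.{u} k ⥤ Type u where
  obj R := GradedPoints p 𝒜 n R
  map {R R'} g := ↾fun f : GradedPoints p 𝒜 n R =>
    (⟨(TruncWittFrame.map g.hom).comp f.1, fun i a ha => by
      obtain ⟨b, hb⟩ := f.2 i a ha
      exact ⟨_, ((congrArg _ hb.symm).trans (TruncWittFrame.map_incl g.hom i b)).symm⟩⟩ :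
      GradedPoints p 𝒜 n R')
  map_id R := by
    ext f
    exact Subtype.ext (AlgHom.ext fun a => TruncWittFrame.map_id _ _)
  map_comp g g' := by
    ext f
    exact Subtype.ext (AlgHom.ext fun a => (TruncWittFrame.map_map _ _ _).symm)

/-- The reduction map `X_{n+1} → X_n`. -/
noncomputable def gradedPointsReduction (n : ℕ) :
    gradedPointsFunctor p 𝒜 (n + 1) ⟶ gradedPointsFunctor p 𝒜 n where
  app R := ↾fun f : GradedPoints p 𝒜 (n + 1) R =>
    (⟨(TruncWittFrame.reduction n.le_succ R).comp f.1, fun i a ha => by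
      obtain ⟨b, hb⟩ := f.2 i a ha
      exact ⟨_, ((congrArg _ hb.symm).trans
        (TruncWittFrame.reduction_incl n.le_succ i b)).symm⟩⟩ : GradedPoints p 𝒜 n R)
  naturality R R' g := by
    ext f
    exact Subtype.ext (AlgHom.ext fun a => TruncWittFrame.reduction_map _ _ _)

end GradedPoints

section Representing

variable {k : Type u} [CommRing k]

/-- The homomorphism `B → B'` corresponding, by the Yoneda lemma, to a natural transformation
`F' ⟶ F` of functors on `k`-algebras, where `B` represents `F` and `B'` represents `F'`. -/
noncomputable def representingHom {F F' : CommAlgCat.{u} k ⥤ Type u} (α : F' ⟶ F)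
    {B B' : CommAlgCat.{u} k} (h : F.CorepresentableBy B) (h' : F'.CorepresentableBy B') : B ⟶ B' :=
  h.homEquiv.symm (α.app B' (h'.homEquiv (𝟙 B')))

end Representing

/-!
Let `B` represent `X_n`. Near a prime `q` of `B`, the constant term of the universal graded point
pulls `q` back to a prime of `A` that contains all `A_i` with `i ≠ 0`. Away from some `f ∈ A_0`
outside this prime, `A` has homogeneous étale coordinates, because the localized differentials have
a basis among the differentials of homogeneous elements. The Witt coefficients of their images are
étale coordinates on `B`: a square-zero extension of `k`-algebras induces a square-zero extension of
truncated Witt frames, and a lift along the latter becomes graded when `A_i` is sent to its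
component of degree `i`. Each coordinate on `A` has `n` Witt coefficients, which gives dimension
`n * d`, and reduction forgets the last of them. It is surjective because the frames of two
consecutive levels form a square-zero extension too, along which graded points lift.
-/

universe v

/-! ### Square-zero kernels and units of truncated Witt vectors -/

theorem mul_eq_zero_of_ker_sq {R S : Type*} [CommRing R] [CommRing S] {f : R →+* S}
    (hsq : RingHom.ker f ^ 2 = ⊥) {x y : R} (hx : f x = 0) (hy : f y = 0) : x * y = 0 := by
  rw [← Ideal.mem_bot, ← hsq, sq]
  exact Ideal.mul_mem_mul hx hy

theorem isUnit_of_isUnit_map_of_ker_sq {R S : Type*} [CommRing R] [CommRing S] {f : R →+* S}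
    (hf : Function.Surjective f) (hsq : RingHom.ker f ^ 2 = ⊥) {x : R} (hx : IsUnit (f x)) :
    IsUnit x := by
  obtain ⟨z, hz⟩ := hx.exists_right_inv
  obtain ⟨y, rfl⟩ := hf z
  have hker : f (x * y - 1) = 0 := by rw [map_sub, map_mul, hz, map_one, sub_self]
  have hnil : IsNilpotent (x * y - 1) := ⟨2, by rw [sq, mul_eq_zero_of_ker_sq hsq hker hker]⟩
  exact isUnit_of_mul_isUnit_left (sub_add_cancel (x * y) 1 ▸ hnil.isUnit_add_one)

namespace TruncWitt

variable {p : ℕ} [Fact p.Prime] {n : ℕ} {R R' : Type*} [CommRing R] [CommRing R']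

theorem coeff_map (f : R →+* R') (x : TruncatedWittVector p n R) (i : Fin n) :
    (map f x).coeff i = f (x.coeff i) := by
  obtain ⟨x, rfl⟩ := WittVector.truncate_surjective p n R x
  rw [map_truncate, WittVector.coeff_truncate, WittVector.coeff_truncate, WittVector.map_coeff]

theorem map_surjective {f : R →+* R'} (hf : Function.Surjective f) :
    Function.Surjective (map (p := p) (n := n) f) := by
  intro y
  choose g hg using hf
  refine ⟨TruncatedWittVector.mk p fun i => g (y.coeff i), TruncatedWittVector.ext fun i => ?_⟩
  rw [coeff_map, TruncatedWittVector.coeff_mk, hg]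

theorem exists_eq_teichmuller_add_verschiebung (x : WittVector p R) :
    ∃ y, x = WittVector.teichmuller p (x.coeff 0) + WittVector.verschiebung y := by
  have h0 : (x - WittVector.teichmuller p (x.coeff 0)).coeff 0 = 0 := by
    rw [← WittVector.constantCoeff_apply, map_sub, WittVector.constantCoeff_apply,
      WittVector.constantCoeff_apply, WittVector.teichmuller_coeff_zero, sub_self]
  exact ⟨_, sub_eq_iff_eq_add'.1 (WittVector.eq_iterate_verschiebung (n := 1) (by simpa using h0))⟩

theorem frobenius_eq_zero_of_coeff_sq (hp : (p : R) = 0) {x : WittVector p R}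
    (hx : ∀ i, x.coeff i ^ 2 = 0) : WittVector.frobenius x = 0 := by
  rcases subsingleton_or_nontrivial R with hR | hR
  · exact WittVector.ext fun i => Subsingleton.elim _ _
  · have : CharP R p := (CharP.charP_iff_prime_eq_zero Fact.out).2 hp
    ext i
    rw [WittVector.coeff_frobenius_charP, WittVector.zero_coeff]
    exact pow_eq_zero_of_le (Fact.out : p.Prime).two_le (hx i)

theorem mul_verschiebung_eq_zero {x : WittVector p R} (hx : WittVector.frobenius x = 0)
    (y : WittVector p R) : x * WittVector.verschiebung y = 0 := by
  rw [mul_comm, ← WittVector.verschiebung_mul_frobenius, hx, mul_zero, map_zero]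

theorem mul_eq_zero_of_coeff_mem (hp : (p : R) = 0) {I : Ideal R} (hI : I ^ 2 = ⊥)
    {x y : WittVector p R} (hx : ∀ i, x.coeff i ∈ I) (hy : ∀ i, y.coeff i ∈ I) : x * y = 0 := by
  have hmul : ∀ {a b : R}, a ∈ I → b ∈ I → a * b = 0 := fun ha hb => by
    rw [← Ideal.mem_bot, ← hI, sq]
    exact Ideal.mul_mem_mul ha hb
  have hsq : ∀ {a : R}, a ∈ I → a ^ 2 = 0 := fun ha => (sq _).trans (hmul ha ha)
  obtain ⟨x', hx'⟩ := exists_eq_teichmuller_add_verschiebung x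
  obtain ⟨y', hy'⟩ := exists_eq_teichmuller_add_verschiebung y
  have hFx : WittVector.frobenius (WittVector.teichmuller p (x.coeff 0)) = 0 :=
    frobenius_eq_zero_of_coeff_sq hp fun i => by
      cases i with
      | zero => rw [WittVector.teichmuller_coeff_zero, hsq (hx 0)]
      | succ i => rw [WittVector.teichmuller_coeff_pos _ _ _ i.succ_pos, zero_pow two_ne_zero]
  have hFy : WittVector.frobenius y = 0 := frobenius_eq_zero_of_coeff_sq hp fun i => hsq (hy i)
  calc x * y = WittVector.teichmuller p (x.coeff 0) * y + y * WittVector.verschiebung x' := by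
        rw [mul_comm y, ← add_mul, ← hx']
    _ = WittVector.teichmuller p (x.coeff 0) * WittVector.teichmuller p (y.coeff 0) := by
        rw [mul_verschiebung_eq_zero hFy, add_zero, congrArg (_ * ·) hy', mul_add,
          mul_verschiebung_eq_zero hFx, add_zero]
    _ = 0 := by rw [← map_mul, hmul (hx 0) (hy 0), WittVector.teichmuller_zero]

theorem ker_map_sq (hp : (p : R) = 0) {f : R →+* R'} (hf : RingHom.ker f ^ 2 = ⊥) :
    RingHom.ker (map (p := p) (n := n) f) ^ 2 = ⊥ := by
  rw [sq, eq_bot_iff, Ideal.mul_le]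
  intro x hx y hy
  have hout : ∀ z ∈ RingHom.ker (map (p := p) (n := n) f), ∀ i, z.out.coeff i ∈ RingHom.ker f := by
    intro z hz i
    by_cases hi : i < n
    · have hzi := congrArg (TruncatedWittVector.coeff ⟨i, hi⟩) (RingHom.mem_ker.1 hz)
      rwa [coeff_map, TruncatedWittVector.coeff_zero, ← TruncatedWittVector.coeff_out] at hzi
    · simp [TruncatedWittVector.out, hi]
  rw [Ideal.mem_bot, ← truncate_out x, ← truncate_out y, ← map_mul,
    mul_eq_zero_of_coeff_mem hp hf (hout x hx) (hout y hy), map_zero]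

theorem ker_truncate_sq (hp : (p : R) = 0) (hn : 1 ≤ n) :
    RingHom.ker (TruncatedWittVector.truncate (p := p) (R := R) n.le_succ) ^ 2 = ⊥ := by
  rcases subsingleton_or_nontrivial R with hR | hR
  · exact eq_bot_iff.2 fun x _ => TruncatedWittVector.ext fun i => Subsingleton.elim _ _
  have : CharP R p := (CharP.charP_iff_prime_eq_zero Fact.out).2 hp
  rw [sq, eq_bot_iff, Ideal.mul_le]
  intro x hx y hy
  obtain ⟨x, rfl⟩ := WittVector.truncate_surjective p _ R x
  obtain ⟨y, rfl⟩ := WittVector.truncate_surjective p _ R y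
  rw [RingHom.mem_ker, TruncatedWittVector.truncate_wittVector_truncate, ← RingHom.mem_ker,
    WittVector.mem_ker_truncate] at hx hy
  rw [Ideal.mem_bot, ← map_mul, WittVector.eq_iterate_verschiebung hx,
    WittVector.eq_iterate_verschiebung hy, WittVector.iterate_verschiebung_mul, ← RingHom.mem_ker,
    WittVector.mem_ker_truncate]
  exact fun i hi => WittVector.iterate_verschiebung_coeff_eq_zero _ (by omega)

/-- The projection `W_n(R) → R` to the first Witt coefficient, for `n ≥ 1`. -/
noncomputable def constantCoeff (hn : 1 ≤ n) : TruncatedWittVector p n R →+* R :=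
  RingHom.liftOfRightInverse (WittVector.truncate n) TruncatedWittVector.out truncate_out
    ⟨WittVector.constantCoeff, fun x hx => (WittVector.mem_ker_truncate n x).1 hx 0 (by omega)⟩

theorem constantCoeff_truncate (hn : 1 ≤ n) (x : WittVector p R) :
    constantCoeff hn (WittVector.truncate n x) = x.coeff 0 :=
  RingHom.liftOfRightInverse_comp_apply _ _ _ _ x

theorem constantCoeff_versch (hn : 1 ≤ n) (x : TruncatedWittVector p n R) :
    constantCoeff hn (versch x) = 0 := by
  obtain ⟨x, rfl⟩ := WittVector.truncate_surjective p n R x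
  rw [versch_truncate, constantCoeff_truncate, WittVector.verschiebung_coeff_zero]

theorem constantCoeff_map (hn : 1 ≤ n) (f : R →+* R') (x : TruncatedWittVector p n R) :
    constantCoeff hn (map f x) = f (constantCoeff hn x) := by
  obtain ⟨x, rfl⟩ := WittVector.truncate_surjective p n R x
  rw [map_truncate, constantCoeff_truncate, constantCoeff_truncate, WittVector.map_coeff]

theorem constantCoeff_truncatedWittVector_truncate (hn : 1 ≤ n) {m : ℕ} (h : n ≤ m)
    (x : TruncatedWittVector p m R) :
    constantCoeff hn (TruncatedWittVector.truncate h x) = constantCoeff (hn.trans h) x := by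
  obtain ⟨x, rfl⟩ := WittVector.truncate_surjective p m R x
  rw [TruncatedWittVector.truncate_wittVector_truncate, constantCoeff_truncate,
    constantCoeff_truncate]

theorem constantCoeff_surjective (hn : 1 ≤ n) :
    Function.Surjective (constantCoeff (p := p) (R := R) hn) := fun r =>
  ⟨WittVector.truncate n (WittVector.teichmuller p r), by
    rw [constantCoeff_truncate, WittVector.teichmuller_coeff_zero]⟩

theorem ker_constantCoeff_one : RingHom.ker (constantCoeff (p := p) (R := R) le_rfl) = ⊥ := by
  refine eq_bot_iff.2 fun x hx => ?_
  obtain ⟨x, rfl⟩ := WittVector.truncate_surjective p 1 R x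
  rw [RingHom.mem_ker, constantCoeff_truncate] at hx
  exact (WittVector.mem_ker_truncate 1 x).2 fun i hi => by rwa [Nat.lt_one_iff.1 hi]

theorem isUnit_of_isUnit_constantCoeff (hp : (p : R) = 0) (hn : 1 ≤ n)
    {x : TruncatedWittVector p n R} (hx : IsUnit (constantCoeff hn x)) : IsUnit x := by
  induction n, hn using Nat.le_induction with
  | base =>
    refine isUnit_of_isUnit_map_of_ker_sq (constantCoeff_surjective le_rfl) ?_ hx
    rw [ker_constantCoeff_one, sq, Ideal.mul_bot]
  | succ n hn ih =>
    rw [← constantCoeff_truncatedWittVector_truncate hn n.le_succ] at hx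
    exact isUnit_of_isUnit_map_of_ker_sq (TruncatedWittVector.truncate_surjective _)
      (ker_truncate_sq hp hn) (ih hx)

end TruncWitt

/-! ### The grading and the constant term of the truncated Witt frame -/

namespace TruncWittFrame

variable {p : ℕ} [Fact p.Prime] {n : ℕ} {k : Type*} [Field k] [CharP k p]

/-- The coordinate in `W_n(R)` of the component of degree `i`, inverse to `incl` on `S_i`. -/
noncomputable def coord (p n : ℕ) [Fact p.Prime] (k R : Type*) [Field k] [CharP k p] [CommRing R]
    [Algebra k R] (i : ℤ) : TruncWittFrame p n k R →+ TruncatedWittVector p n R :=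
  DFinsupp.evalAddMonoidHom (β := Piece p n k R) i

section

variable {R : Type*} [CommRing R] [Algebra k R]

theorem ext_coord {x y : TruncWittFrame p n k R} (h : ∀ i, coord p n k R i x = coord p n k R i y) :
    x = y :=
  DFinsupp.ext h

@[simp]
theorem coord_incl_self (i : ℤ) (a : TruncatedWittVector p n R) :
    coord p n k R i (incl p n k R i a) = a :=
  DirectSum.of_eq_same (β := Piece p n k R) i a

theorem coord_incl_of_ne {i j : ℤ} (h : i ≠ j) (a : TruncatedWittVector p n R) :
    coord p n k R j (incl p n k R i a) = 0 :=
  DirectSum.of_eq_of_ne (β := Piece p n k R) i j a h.symm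

theorem incl_coord_of_mem {i : ℤ} {x : TruncWittFrame p n k R}
    (hx : x ∈ (incl p n k R i).range) : incl p n k R i (coord p n k R i x) = x := by
  obtain ⟨a, rfl⟩ := hx
  rw [coord_incl_self]

variable (p n k R) in
/-- The homogeneous component `S_i` of `S`, as a `W(k)`-submodule. -/
noncomputable def grading (i : ℤ) : Submodule (WittVector p k) (TruncWittFrame p n k R) where
  __ := (incl p n k R i).range
  smul_mem' := by
    rintro c _ ⟨a, rfl⟩
    refine ⟨mul (natCast_eq_zero p k R) 0 i
      (WittVector.truncate n (WittVector.map (algebraMap k R) c)) a, ?_⟩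
    rw [Algebra.smul_def]
    refine Eq.trans ?_ (incl_mul_incl (k := k) 0 i _ a).symm
    rw [zero_add]
    rfl

theorem incl_mem_grading (i : ℤ) (a : TruncatedWittVector p n R) :
    incl p n k R i a ∈ grading p n k R i :=
  ⟨a, rfl⟩

open DirectSum in
/-- The decomposition of `S` into homogeneous components, as required by
`DirectSum.Decomposition.ofAddHom`. -/
noncomputable def decomposeHom : TruncWittFrame p n k R →+ ⨁ i, grading p n k R i :=
  DirectSum.toAddMonoid (β := Piece p n k R) fun i =>
    (DirectSum.of (fun i => grading p n k R i) i).comp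
      ((incl p n k R i).codRestrict (grading p n k R i) (incl_mem_grading i))

theorem decomposeHom_incl (i : ℤ) (a : TruncatedWittVector p n R) :
    decomposeHom (incl p n k R i a) =
      DirectSum.of (fun i => grading p n k R i) i ⟨incl p n k R i a, incl_mem_grading i a⟩ :=
  DirectSum.toAddMonoid_of (β := Piece p n k R) _ i a

noncomputable instance : GradedAlgebra (grading p n k R) where
  one_mem := ⟨1, (inclZero p n k R).map_one⟩
  mul_mem := by
    rintro i j _ _ ⟨a, rfl⟩ ⟨b, rfl⟩
    exact ⟨_, (incl_mul_incl i j a b).symm⟩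
  __ := DirectSum.Decomposition.ofAddHom (grading p n k R) decomposeHom
    (by
      refine induction_incl fun i a => ?_
      rw [AddMonoidHom.comp_apply, decomposeHom_incl, DirectSum.coeAddMonoidHom_of]
      rfl)
    (by
      refine DirectSum.addHom_ext fun i a => ?_
      obtain ⟨_, a, rfl⟩ := a
      rw [AddMonoidHom.comp_apply, DirectSum.coeAddMonoidHom_of]
      exact decomposeHom_incl i a)

theorem coe_decompose (i : ℤ) (x : TruncWittFrame p n k R) :
    (DirectSum.decompose (grading p n k R) x i : TruncWittFrame p n k R) =
      incl p n k R i (coord p n k R i x) := by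
  refine DFunLike.congr_fun (f := (GradedRing.proj (grading p n k R) i))
    (g := (incl p n k R i).comp (coord p n k R i)) (induction_incl fun j a => ?_) x
  rw [GradedRing.proj_apply, AddMonoidHom.comp_apply]
  obtain rfl | h := eq_or_ne j i
  · rw [coord_incl_self, DirectSum.decompose_of_mem_same (grading p n k R) (incl_mem_grading j a)]
  · rw [coord_incl_of_ne h, map_zero,
      DirectSum.decompose_of_mem_ne (grading p n k R) (incl_mem_grading j a) h]

theorem exists_eq_sum_incl_coord (x : TruncWittFrame p n k R) :
    ∃ s : Finset ℤ, x = ∑ i ∈ s, incl p n k R i (coord p n k R i x) := by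
  classical
  refine ⟨DFinsupp.support (DirectSum.decompose (grading p n k R) x), ?_⟩
  conv_lhs => rw [← DirectSum.sum_support_decompose (grading p n k R) x]
  exact Finset.sum_congr rfl fun i _ => coe_decompose i x

end

section mapRingHom

variable {m : ℕ} {R R' : Type*} [CommRing R] [Algebra k R] [CommRing R'] [Algebra k R']
  {f : TruncatedWittVector p n R →+* TruncatedWittVector p m R'}
  (hV : ∀ x, f (TruncWitt.versch x) = TruncWitt.versch (f x))
  (hF : ∀ x, f (TruncWitt.frob (natCast_eq_zero p k R) x) =
    TruncWitt.frob (natCast_eq_zero p k R') (f x))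

theorem coord_mapRingHom (i : ℤ) (x : TruncWittFrame p n k R) :
    coord p m k R' i (mapRingHom f hV hF x) = f (coord p n k R i x) := by
  refine DFunLike.congr_fun
    (f := (coord p m k R' i).comp (mapRingHom (k := k) f hV hF).toAddMonoidHom)
    (g := f.toAddMonoidHom.comp (coord p n k R i)) (induction_incl fun j a => ?_) x
  change coord p m k R' i (mapRingHom f hV hF (incl p n k R j a)) =
    f (coord p n k R i (incl p n k R j a))
  rw [mapRingHom_incl]
  obtain rfl | h := eq_or_ne j i
  · rw [coord_incl_self, coord_incl_self]
  · rw [coord_incl_of_ne h, coord_incl_of_ne h, map_zero]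

theorem mapRingHom_surjective (hf : Function.Surjective f) :
    Function.Surjective (mapRingHom (k := k) f hV hF) := by
  intro y
  choose g hg using hf
  obtain ⟨s, hs⟩ := exists_eq_sum_incl_coord y
  refine ⟨∑ i ∈ s, incl p n k R i (g (coord p m k R' i y)), ?_⟩
  rw [map_sum, hs]
  refine Finset.sum_congr rfl fun i _ => ?_
  rw [mapRingHom_incl, hg, ← hs]

include hV in
theorem map_tau_eq_zero (i : ℤ) {x : TruncatedWittVector p n R} (hx : f x = 0) :
    f (tau i x) = 0 := by
  rcases le_or_gt i 0 with hi | hi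
  · rwa [tau_nonpos hi]
  · rw [tau_pos hi, map_mul, hV, hx, map_zero, mul_zero]

include hF in
theorem map_sigma_eq_zero (i : ℤ) {x : TruncatedWittVector p n R} (hx : f x = 0) :
    f (sigma (natCast_eq_zero p k R) i x) = 0 := by
  rcases le_or_gt i 0 with hi | hi
  · rw [sigma_nonpos _ hi, map_mul, hF, hx, map_zero, mul_zero]
  · rwa [sigma_pos _ hi]

include hV hF in
theorem mul_eq_zero_of_map_eq_zero (hf : RingHom.ker f ^ 2 = ⊥) (i j : ℤ)
    {a b : TruncatedWittVector p n R} (ha : f a = 0) (hb : f b = 0) :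
    mul (natCast_eq_zero p k R) i j a b = 0 := by
  unfold mul
  split_ifs
  · exact mul_eq_zero_of_ker_sq hf (map_tau_eq_zero hV i ha) (map_tau_eq_zero hV j hb)
  · exact mul_eq_zero_of_ker_sq hf (map_sigma_eq_zero (k := k) hF i ha)
      (map_sigma_eq_zero (k := k) hF j hb)

theorem ker_mapRingHom_sq (hf : RingHom.ker f ^ 2 = ⊥) :
    RingHom.ker (mapRingHom (k := k) f hV hF) ^ 2 = ⊥ := by
  rw [sq, eq_bot_iff, Ideal.mul_le]
  intro x hx y hy
  have hcoord : ∀ z ∈ RingHom.ker (mapRingHom (k := k) f hV hF), ∀ i,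
      f (coord p n k R i z) = 0 := fun z hz i => by
    rw [← coord_mapRingHom (k := k) hV hF, RingHom.mem_ker.1 hz, map_zero]
  obtain ⟨s, hs⟩ := exists_eq_sum_incl_coord x
  obtain ⟨t, ht⟩ := exists_eq_sum_incl_coord y
  rw [Ideal.mem_bot, hs, ht, Finset.sum_mul_sum]
  refine Finset.sum_eq_zero fun i _ => Finset.sum_eq_zero fun j _ => ?_
  rw [incl_mul_incl,
    mul_eq_zero_of_map_eq_zero (k := k) hV hF hf i j (hcoord x hx i) (hcoord y hy j), map_zero]

end mapRingHom

section

variable {R R' : Type*} [CommRing R] [Algebra k R] [CommRing R'] [Algebra k R']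

theorem coord_map (f : R →ₐ[k] R') (i : ℤ) (x : TruncWittFrame p n k R) :
    coord p n k R' i (map f x) = TruncWitt.map f.toRingHom (coord p n k R i x) :=
  coord_mapRingHom (TruncWitt.map_versch _) (TruncWitt.map_frob _ _ _) i x

theorem coeff_coord_map (f : R →ₐ[k] R') (i : ℤ) (x : TruncWittFrame p n k R) (m : Fin n) :
    (coord p n k R' i (map f x)).coeff m = f ((coord p n k R i x).coeff m) := by
  rw [coord_map, TruncWitt.coeff_map]
  rfl

theorem map_surjective {f : R →ₐ[k] R'} (hf : Function.Surjective f) :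
    Function.Surjective (map (p := p) (n := n) f) :=
  mapRingHom_surjective (TruncWitt.map_versch _) (TruncWitt.map_frob _ _ _)
    (TruncWitt.map_surjective hf)

theorem ker_map_sq {f : R →ₐ[k] R'} (hf : RingHom.ker f ^ 2 = ⊥) :
    RingHom.ker (map (p := p) (n := n) f) ^ 2 = ⊥ :=
  ker_mapRingHom_sq (TruncWitt.map_versch _) (TruncWitt.map_frob _ _ _)
    (TruncWitt.ker_map_sq (natCast_eq_zero p k R) hf)

theorem map_mem_grading (f : R →ₐ[k] R') {i : ℤ} {x : TruncWittFrame p n k R}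
    (hx : x ∈ grading p n k R i) : map f x ∈ grading p n k R' i := by
  obtain ⟨a, rfl⟩ := hx
  exact ⟨_, (map_incl f i a).symm⟩

theorem coord_reduction {m : ℕ} (h : n ≤ m) (i : ℤ) (x : TruncWittFrame p m k R) :
    coord p n k R i (reduction h R x) = TruncatedWittVector.truncate h (coord p m k R i x) :=
  coord_mapRingHom (TruncWitt.truncate_versch h) (TruncWitt.truncate_frob h _) i x

variable (R) in
theorem reduction_surjective {m : ℕ} (h : n ≤ m) :
    Function.Surjective (reduction (p := p) (k := k) h R) :=
  mapRingHom_surjective (TruncWitt.truncate_versch _) (TruncWitt.truncate_frob _ _)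
    (TruncatedWittVector.truncate_surjective _)

variable (R) in
theorem ker_reduction_sq (hn : 1 ≤ n) :
    RingHom.ker (reduction (p := p) (k := k) n.le_succ R) ^ 2 = ⊥ :=
  ker_mapRingHom_sq (TruncWitt.truncate_versch _) (TruncWitt.truncate_frob _ _)
    (TruncWitt.ker_truncate_sq (natCast_eq_zero p k R) hn)

theorem reduction_mem_grading {m : ℕ} (h : n ≤ m) {i : ℤ} {x : TruncWittFrame p m k R}
    (hx : x ∈ grading p m k R i) : reduction h R x ∈ grading p n k R i := by
  obtain ⟨a, rfl⟩ := hx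
  exact ⟨_, (reduction_incl h i a).symm⟩

-- The product of two elements of opposite nonzero degrees is a multiple of a Verschiebung.
theorem constantCoeff_coord_zero_incl_mul_incl (hn : 1 ≤ n) (i j : ℤ)
    (a b : TruncatedWittVector p n R) :
    TruncWitt.constantCoeff hn (coord p n k R 0 (incl p n k R i a * incl p n k R j b)) =
      TruncWitt.constantCoeff hn (coord p n k R 0 (incl p n k R i a)) *
        TruncWitt.constantCoeff hn (coord p n k R 0 (incl p n k R j b)) := by
  have tau_of_pos : ∀ {l : ℤ} (c : TruncatedWittVector p n R), 0 < l →
      TruncWitt.constantCoeff hn (tau l c) = 0 := fun c hl => by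
    rw [tau_pos hl, map_mul, TruncWitt.constantCoeff_versch, mul_zero]
  rw [incl_mul_incl]
  by_cases hij : i + j = 0
  · obtain rfl : j = -i := by omega
    rw [mul, if_pos hij.le, hij, coord_incl_self, map_mul]
    rcases lt_trichotomy i 0 with hi | rfl | hi
    · rw [tau_of_pos b (by omega), mul_zero, coord_incl_of_ne hi.ne, map_zero, zero_mul]
    · rw [neg_zero, tau_nonpos le_rfl, tau_nonpos le_rfl, coord_incl_self, coord_incl_self]
    · rw [tau_of_pos a hi, zero_mul, coord_incl_of_ne hi.ne', map_zero, zero_mul]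
  · rw [coord_incl_of_ne hij, map_zero]
    rcases ne_or_eq i 0 with hi | hi
    · rw [coord_incl_of_ne hi, map_zero, zero_mul]
    · rw [coord_incl_of_ne (show j ≠ 0 by omega), map_zero, mul_zero]

variable (p k R) in
/-- The ring homomorphism `S → R` given by the first Witt coefficient of the component of degree
zero. -/
noncomputable def constantTerm (hn : 1 ≤ n) : TruncWittFrame p n k R →+* R where
  __ := (TruncWitt.constantCoeff hn).toAddMonoidHom.comp (coord p n k R 0)
  map_one' := (congrArg (TruncWitt.constantCoeff hn) (coord_incl_self (k := k) 0 1)).trans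
    (map_one _)
  map_mul' x y := by
    change TruncWitt.constantCoeff hn (coord p n k R 0 (x * y)) =
      TruncWitt.constantCoeff hn (coord p n k R 0 x) *
        TruncWitt.constantCoeff hn (coord p n k R 0 y)
    obtain ⟨s, hs⟩ := exists_eq_sum_incl_coord x
    obtain ⟨t, ht⟩ := exists_eq_sum_incl_coord y
    rw [hs, ht]
    simp only [Finset.sum_mul_sum, map_sum, constantCoeff_coord_zero_incl_mul_incl]

theorem constantTerm_apply (hn : 1 ≤ n) (x : TruncWittFrame p n k R) :
    constantTerm p k R hn x = TruncWitt.constantCoeff hn (coord p n k R 0 x) :=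
  rfl

theorem constantTerm_eq_zero_of_mem (hn : 1 ≤ n) {i : ℤ} (hi : i ≠ 0) {x : TruncWittFrame p n k R}
    (hx : x ∈ grading p n k R i) : constantTerm p k R hn x = 0 := by
  obtain ⟨a, rfl⟩ := hx
  rw [constantTerm_apply, coord_incl_of_ne hi, map_zero]

theorem constantTerm_map (hn : 1 ≤ n) (f : R →ₐ[k] R') (x : TruncWittFrame p n k R) :
    constantTerm p k R' hn (map f x) = f (constantTerm p k R hn x) := by
  rw [constantTerm_apply, coord_map, TruncWitt.constantCoeff_map]
  rfl

theorem constantTerm_reduction (hn : 1 ≤ n) {m : ℕ} (h : n ≤ m) (x : TruncWittFrame p m k R) :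
    constantTerm p k R hn (reduction h R x) = constantTerm p k R (hn.trans h) x := by
  rw [constantTerm_apply, coord_reduction, TruncWitt.constantCoeff_truncatedWittVector_truncate]
  rfl

theorem isUnit_of_isUnit_constantTerm (hn : 1 ≤ n) {x : TruncWittFrame p n k R}
    (hx : x ∈ grading p n k R 0) (h : IsUnit (constantTerm p k R hn x)) : IsUnit x := by
  obtain ⟨a, rfl⟩ := hx
  rw [constantTerm_apply, coord_incl_self] at h
  exact (TruncWitt.isUnit_of_isUnit_constantCoeff (natCast_eq_zero p k R) hn h).map
    (inclZero p n k R)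

end

end TruncWittFrame

/-! ### Homomorphisms of graded algebras given in components -/

section GradedHom

variable {ι W A B : Type*} [DecidableEq ι] [AddMonoid ι] [CommRing W] [CommRing A] [Algebra W A]
  [Ring B] [Algebra W B] (𝒜 : ι → Submodule W A) [GradedAlgebra 𝒜]

/-- The algebra homomorphism out of a graded algebra with given restrictions to the homogeneous
components. -/
noncomputable def algHomOfComponents (f : ∀ i, 𝒜 i →ₗ[W] B)
    (hone : f 0 ⟨1, SetLike.GradedOne.one_mem⟩ = 1)
    (hmul : ∀ (i j : ι) (a : 𝒜 i) (b : 𝒜 j),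
      f (i + j) ⟨a * b, SetLike.GradedMul.mul_mem a.2 b.2⟩ = f i a * f j b) : A →ₐ[W] B :=
  (DirectSum.toAlgebra W (fun i => 𝒜 i) f hone (fun {i j} a b => hmul i j a b)).comp
    (DirectSum.decomposeAlgEquiv 𝒜).toAlgHom

theorem algHomOfComponents_apply {f : ∀ i, 𝒜 i →ₗ[W] B}
    (hone : f 0 ⟨1, SetLike.GradedOne.one_mem⟩ = 1)
    (hmul : ∀ (i j : ι) (a : 𝒜 i) (b : 𝒜 j),
      f (i + j) ⟨a * b, SetLike.GradedMul.mul_mem a.2 b.2⟩ = f i a * f j b)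
    {i : ι} {a : A} (ha : a ∈ 𝒜 i) : algHomOfComponents 𝒜 f hone hmul a = f i ⟨a, ha⟩ := by
  change DirectSum.toAlgebra W (fun i => 𝒜 i) f hone (fun {i j} a b => hmul i j a b)
    (DirectSum.decompose 𝒜 a) = _
  rw [DirectSum.decompose_of_mem 𝒜 ha]
  exact DirectSum.toAddMonoid_of (fun i => (f i).toAddMonoidHom) i ⟨a, ha⟩

end GradedHom

section GradedLift

variable {ι W A S S' : Type*} [DecidableEq ι] [AddCancelMonoid ι] [CommRing W] [CommRing A]
  [CommRing S] [CommRing S'] [Algebra W A] [Algebra W S] [Algebra W S']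
  {𝒜 : ι → Submodule W A} [GradedAlgebra 𝒜] {𝒮 : ι → Submodule W S} [GradedAlgebra 𝒮]
  {𝒮' : ι → Submodule W S'} [GradedAlgebra 𝒮']

theorem coe_decompose_mul_add_of_sub_mul_sub_eq_zero {i j : ι} {x y : S}
    (h : (x - DirectSum.decompose 𝒮 x i) * (y - DirectSum.decompose 𝒮 y j) = 0) :
    (DirectSum.decompose 𝒮 (x * y) (i + j) : S) =
      DirectSum.decompose 𝒮 x i * DirectSum.decompose 𝒮 y j := by
  set α := DirectSum.decompose 𝒮 x i with hα
  set β := DirectSum.decompose 𝒮 y j with hβ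
  have hxy : x * y = α * y + x * β - (α : S) * β := by linear_combination h
  rw [hxy, DirectSum.decompose_sub, DirectSum.decompose_add, DirectSum.sub_apply,
    DirectSum.add_apply, AddSubgroupClass.coe_sub, Submodule.coe_add,
    DirectSum.coe_decompose_mul_add_of_left_mem 𝒮 α.2,
    DirectSum.coe_decompose_mul_add_of_right_mem 𝒮 β.2,
    DirectSum.decompose_of_mem_same 𝒮 (SetLike.GradedMul.mul_mem α.2 β.2), ← hα, ← hβ,
    add_sub_cancel_right]

theorem exists_gradedAlgHom_eq_coe_decompose (g : A →ₐ[W] S)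
    (hg : ∀ i j, ∀ a ∈ 𝒜 i, ∀ b ∈ 𝒜 j,
      (g a - DirectSum.decompose 𝒮 (g a) i) * (g b - DirectSum.decompose 𝒮 (g b) j) = 0) :
    ∃ ψ : 𝒜 →ₐᵍ[W] 𝒮, ∀ i, ∀ a ∈ 𝒜 i, ψ a = DirectSum.decompose 𝒮 (g a) i := by
  let f : ∀ i, 𝒜 i →ₗ[W] S := fun i =>
    (GradedAlgebra.proj 𝒮 i) ∘ₗ g.toLinearMap ∘ₗ (𝒜 i).subtype
  have hone : f 0 ⟨1, SetLike.GradedOne.one_mem⟩ = 1 := by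
    change ((DirectSum.decompose 𝒮 (g (1 : A)) 0 : 𝒮 0) : S) = 1
    rw [map_one, DirectSum.decompose_of_mem_same 𝒮 SetLike.GradedOne.one_mem]
  have hmul : ∀ (i j : ι) (a : 𝒜 i) (b : 𝒜 j),
      f (i + j) ⟨a * b, SetLike.GradedMul.mul_mem a.2 b.2⟩ = f i a * f j b := fun i j a b =>
    (congrArg (fun s => (DirectSum.decompose 𝒮 s (i + j) : S)) (map_mul g _ _)).trans
      (coe_decompose_mul_add_of_sub_mul_sub_eq_zero (hg i j a a.2 b b.2))
  have happly : ∀ i, ∀ a ∈ 𝒜 i,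
      algHomOfComponents 𝒜 f hone hmul a = DirectSum.decompose 𝒮 (g a) i :=
    fun i a ha => algHomOfComponents_apply 𝒜 hone hmul ha
  exact ⟨⟨algHomOfComponents 𝒜 f hone hmul,
    fun {i a} ha => (happly i a ha).symm ▸ SetLike.coe_mem _⟩, happly⟩

/-- Taking on `A_i` the component of `g` of degree `i` is multiplicative because the error terms lie
in the square-zero ideal `ker π`. -/
theorem exists_gradedAlgHom_of_comp_eq {π : 𝒮 →ₐᵍ[W] 𝒮'} (hπ : RingHom.ker π ^ 2 = ⊥)
    {g : A →ₐ[W] S} {φ : 𝒜 →ₐᵍ[W] 𝒮'} (hg : ∀ a, π (g a) = φ a) :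
    ∃ ψ : 𝒜 →ₐᵍ[W] 𝒮, (∀ i, ∀ a ∈ 𝒜 i, ψ a = DirectSum.decompose 𝒮 (g a) i) ∧
      ∀ a, π (ψ a) = φ a := by
  have hπg : ∀ i, ∀ a ∈ 𝒜 i, π (DirectSum.decompose 𝒮 (g a) i) = φ a := fun i a ha => by
    rw [map_directSumDecompose, hg, DirectSum.decompose_of_mem_same 𝒮' (GradedFunLike.map_mem φ ha)]
  have hker : ∀ i, ∀ a ∈ 𝒜 i, π (g a - DirectSum.decompose 𝒮 (g a) i) = 0 := fun i a ha => by
    rw [map_sub, hπg i a ha, hg, sub_self]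
  obtain ⟨ψ, hψ⟩ := exists_gradedAlgHom_eq_coe_decompose g fun i j a ha b hb =>
    mul_eq_zero_of_ker_sq hπ (hker i a ha) (hker j b hb)
  refine ⟨ψ, hψ, fun a => ?_⟩
  induction a using DirectSum.Decomposition.inductionOn 𝒜 with
  | zero => rw [map_zero, map_zero, map_zero]
  | @homogeneous i a => rw [hψ i a a.2, hπg i a a.2]
  | add a b ha hb => rw [map_add, map_add, map_add, ha, hb]

end GradedLift

/-! ### Degree zero components of annihilators of differentials -/

section GradedDifferentials

variable {ι W A : Type*} [CommRing W] [CommRing A] [Algebra W A]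

/-- The module `∏_{m ∈ ι} M` over a graded ring `A`, on which `a ∈ A_i` acts by multiplication with
`a` and a shift by `i`. A derivation `A → M` applied in all degrees is a derivation to it, which
makes degrees visible in an `A`-linear map on differentials without grading `Ω[A⁄W]`. -/
def ShiftModule (_𝒜 : ι → Submodule W A) (M : Type*) : Type _ := ι → M

namespace ShiftModule

variable (𝒜 : ι → Submodule W A) (M : Type*) [AddCommGroup M]

instance : AddCommGroup (ShiftModule 𝒜 M) := inferInstanceAs (AddCommGroup (ι → M))

variable {𝒜 M} in
theorem add_apply (c c' : ShiftModule 𝒜 M) (m : ι) : (c + c') m = c m + c' m :=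
  rfl

variable [AddCommGroup ι] [DecidableEq ι] [GradedAlgebra 𝒜] [Module W M] [Module A M]
  [IsScalarTower W A M]

instance : Module W (ShiftModule 𝒜 M) := inferInstanceAs (Module W (ι → M))

/-- The action of a homogeneous element on the shift module. -/
def shift (i : ι) : 𝒜 i →ₗ[W] Module.End W (ShiftModule 𝒜 M) where
  toFun a :=
    { toFun := fun c m => (a : A) • c (m - i)
      map_add' := fun c c' => funext fun m => smul_add (a : A) (c (m - i)) (c' (m - i))
      map_smul' := fun w c => funext fun m => smul_algebra_smul_comm w (a : A) (c (m - i)) }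
  map_add' a b := LinearMap.ext fun c => funext fun m => add_smul (a : A) (b : A) (c (m - i))
  map_smul' w a := LinearMap.ext fun c => funext fun m => smul_assoc w (a : A) (c (m - i))

/-- The action of a graded ring on the shift module. -/
noncomputable def action : A →ₐ[W] Module.End W (ShiftModule 𝒜 M) :=
  algHomOfComponents 𝒜 (shift 𝒜 M)
    (LinearMap.ext fun c => funext fun m => by
      change (1 : A) • c (m - 0) = c m
      rw [one_smul, sub_zero])
    (fun i j a b => LinearMap.ext fun c => funext fun m => by
      change ((a : A) * b) • c (m - (i + j)) = (a : A) • (b : A) • c (m - i - j)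
      rw [mul_smul, sub_sub])

noncomputable instance : Module A (ShiftModule 𝒜 M) :=
  Module.compHom (ShiftModule 𝒜 M) (action 𝒜 M).toRingHom

instance : IsScalarTower W A (ShiftModule 𝒜 M) :=
  ⟨fun w a c => by
    change action 𝒜 M (w • a) c = w • action 𝒜 M a c
    rw [map_smul, LinearMap.smul_apply]⟩

variable {𝒜 M}

theorem smul_apply {i : ι} {a : A} (ha : a ∈ 𝒜 i) (c : ShiftModule 𝒜 M) (m : ι) :
    (a • c) m = a • c (m - i) := by
  have h : action 𝒜 M a = shift 𝒜 M i ⟨a, ha⟩ := algHomOfComponents_apply 𝒜 _ _ ha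
  change action 𝒜 M a c m = _
  rw [h]
  rfl

omit [IsScalarTower W A M] in
theorem apply_coe_decompose_mul (δ : Derivation W A M) {i j : ι} {x y : A} (hx : x ∈ 𝒜 i)
    (hy : y ∈ 𝒜 j) (m : ι) :
    δ (DirectSum.decompose 𝒜 (x * y) m) =
      x • δ (DirectSum.decompose 𝒜 y (m - i)) + y • δ (DirectSum.decompose 𝒜 x (m - j)) := by
  obtain rfl | h := eq_or_ne (i + j) m
  · rw [DirectSum.decompose_of_mem_same 𝒜 (SetLike.GradedMul.mul_mem hx hy), add_sub_cancel_left,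
      add_sub_cancel_right, DirectSum.decompose_of_mem_same 𝒜 hx,
      DirectSum.decompose_of_mem_same 𝒜 hy, Derivation.leibniz]
  · rw [DirectSum.decompose_of_mem_ne 𝒜 (SetLike.GradedMul.mul_mem hx hy) h,
      DirectSum.decompose_of_mem_ne 𝒜 hx fun h' => h (eq_sub_iff_add_eq.1 h'),
      DirectSum.decompose_of_mem_ne 𝒜 hy fun h' => h (eq_sub_iff_add_eq'.1 h'), map_zero,
      smul_zero, smul_zero, add_zero]

variable (𝒜) in
/-- The derivation with values in the shift module given by a derivation on all homogeneous
components. -/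
noncomputable def derivation (δ : Derivation W A M) : Derivation W A (ShiftModule 𝒜 M) :=
  Derivation.mk' (M := ShiftModule 𝒜 M)
    { toFun := fun y m => δ (DirectSum.decompose 𝒜 y m)
      map_add' := fun x y => funext fun m => by
        rw [DirectSum.decompose_add, DirectSum.add_apply, Submodule.coe_add, map_add]
        rfl
      map_smul' := fun w y => funext fun m => by
        rw [DirectSum.decompose_smul, DirectSum.smul_apply, Submodule.coe_smul, Derivation.map_smul]
        rfl }
    (by
      intro x y
      induction x using DirectSum.Decomposition.inductionOn 𝒜 with
      | zero => simp
      | add x x' hx hx' => rw [add_mul, map_add, map_add, hx, hx', add_smul, smul_add]; abel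
      | @homogeneous i x =>
      induction y using DirectSum.Decomposition.inductionOn 𝒜 with
      | zero => simp
      | add y y' hy hy' => rw [mul_add, map_add, map_add, hy, hy', add_smul, smul_add]; abel
      | @homogeneous j y =>
      funext m
      rw [add_apply, smul_apply x.2, smul_apply y.2]
      exact apply_coe_decompose_mul δ x.2 y.2 m)

theorem derivation_apply (δ : Derivation W A M) (y : A) (m : ι) :
    derivation 𝒜 δ y m = δ (DirectSum.decompose 𝒜 y m) :=
  rfl

theorem derivation_eq_zero {δ : Derivation W A M} {y : A} (hy : SetLike.IsHomogeneousElem 𝒜 y)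
    (hδ : δ y = 0) : derivation 𝒜 δ y = 0 := by
  obtain ⟨e, he⟩ := hy
  refine funext fun m => (derivation_apply δ y m).trans ?_
  obtain rfl | h := eq_or_ne e m
  · rw [DirectSum.decompose_of_mem_same 𝒜 he, hδ]
    rfl
  · rw [DirectSum.decompose_of_mem_ne 𝒜 he h, map_zero]
    rfl

theorem smul_derivation_apply (δ : Derivation W A M) {e : ι} {y : A} (hy : y ∈ 𝒜 e) (g : A) :
    (g • derivation 𝒜 δ y) e = (DirectSum.decompose 𝒜 g 0 : A) • δ y := by
  induction g using DirectSum.Decomposition.inductionOn 𝒜 with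
  | zero =>
    rw [zero_smul, DirectSum.decompose_zero, DirectSum.zero_apply, Submodule.coe_zero, zero_smul]
    rfl
  | add g g' h h' =>
    rw [add_smul, add_apply, h, h', DirectSum.decompose_add, DirectSum.add_apply,
      Submodule.coe_add, add_smul]
  | @homogeneous i g =>
    rw [smul_apply g.2, derivation_apply]
    obtain rfl | h := eq_or_ne i 0
    · rw [sub_zero, DirectSum.decompose_of_mem_same 𝒜 hy, DirectSum.decompose_of_mem_same 𝒜 g.2]
    · rw [DirectSum.decompose_of_mem_ne 𝒜 g.2 h,
        DirectSum.decompose_of_mem_ne 𝒜 hy fun h' => h (sub_eq_self.1 h'.symm), map_zero, smul_zero,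
        zero_smul]

end ShiftModule

open KaehlerDifferential

variable [AddCommGroup ι] [DecidableEq ι] {𝒜 : ι → Submodule W A} [GradedAlgebra 𝒜] {κ : Type*}
  {a : κ → A}

theorem decompose_zero_smul_apply_eq_zero {M : Type*} [AddCommGroup M] [Module W M] [Module A M]
    [IsScalarTower W A M] (ha : ∀ j, SetLike.IsHomogeneousElem 𝒜 (a j)) {g : A}
    (hg : ∀ ω : Ω[A⁄W], g • ω ∈ Submodule.span A (Set.range fun j => D W A (a j)))
    {δ : Derivation W A M} (hδ : ∀ j, δ (a j) = 0) (y : A) :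
    (DirectSum.decompose 𝒜 g 0 : A) • δ y = 0 := by
  let ℓ := (ShiftModule.derivation 𝒜 δ).liftKaehlerDifferential
  have hℓ : ∀ y, ℓ (D W A y) = ShiftModule.derivation 𝒜 δ y :=
    (ShiftModule.derivation 𝒜 δ).liftKaehlerDifferential_comp_D
  have hspan : Submodule.span A (Set.range fun j => D W A (a j)) ≤ LinearMap.ker ℓ := by
    rw [Submodule.span_le]
    rintro _ ⟨j, rfl⟩
    exact (hℓ _).trans (ShiftModule.derivation_eq_zero (ha j) (hδ j))
  induction y using DirectSum.Decomposition.inductionOn 𝒜 with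
  | zero => rw [map_zero, smul_zero]
  | add y y' h h' => rw [map_add, smul_add, h, h', add_zero]
  | @homogeneous i y =>
    rw [← ShiftModule.smul_derivation_apply δ y.2 g, ← hℓ, ← map_smul, hspan (hg _)]
    rfl

theorem decompose_zero_smul_mem_span (ha : ∀ j, SetLike.IsHomogeneousElem 𝒜 (a j)) {g : A}
    (hg : ∀ ω : Ω[A⁄W], g • ω ∈ Submodule.span A (Set.range fun j => D W A (a j))) (ω : Ω[A⁄W]) :
    (DirectSum.decompose 𝒜 g 0 : A) • ω ∈ Submodule.span A (Set.range fun j => D W A (a j)) := by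
  set N := Submodule.span A (Set.range fun j => D W A (a j))
  have hD : ∀ y, (DirectSum.decompose 𝒜 g 0 : A) • D W A y ∈ N := fun y =>
    (Submodule.Quotient.mk_eq_zero N).1 <| decompose_zero_smul_apply_eq_zero ha hg
      (δ := N.mkQ.compDer (D W A))
      (fun j => (Submodule.Quotient.mk_eq_zero N).2 (Submodule.subset_span ⟨j, rfl⟩)) y
  have htop : ⊤ ≤ N.comap (LinearMap.lsmul A _ (DirectSum.decompose 𝒜 g 0 : A)) := by
    rw [← span_range_derivation, Submodule.span_le]
    rintro _ ⟨y, rfl⟩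
    exact hD y
  exact htop Submodule.mem_top

end GradedDifferentials

/-! ### Homogeneous étale coordinates -/

section Coordinates

open KaehlerDifferential TensorProduct

theorem formallyEtale_of_mapBaseChange_bijective {R S T : Type*} [CommRing R] [CommRing S]
    [CommRing T] [Algebra R S] [Algebra R T] [Algebra S T] [IsScalarTower R S T]
    [Algebra.FormallySmooth R T] (h : Function.Bijective (mapBaseChange R S T)) :
    Algebra.FormallyEtale S T where
  subsingleton_kaehlerDifferential := by
    refine subsingleton_of_forall_eq 0 fun x => ?_
    obtain ⟨y, rfl⟩ := KaehlerDifferential.map_surjective R S T x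
    exact ((exact_mapBaseChange_map R S T) y).2 (h.2 y)
  subsingleton_h1Cotangent := by
    refine subsingleton_of_forall_eq 0 fun x => ?_
    have hx : Algebra.H1Cotangent.δ R S T x = 0 := h.1 <|
      ((Algebra.H1Cotangent.exact_δ_mapBaseChange R S T _).2 ⟨x, rfl⟩).trans (map_zero _).symm
    obtain ⟨y, rfl⟩ := (Algebra.H1Cotangent.exact_map_δ R S T x).1 hx
    rw [Subsingleton.elim y 0, map_zero]

variable {W A : Type u} [CommRing W] [CommRing A] [Algebra W A] {d : ℕ}

theorem smooth_of_locally_isStandardSmoothOfRelativeDimension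
    (h : RingHom.Locally (RingHom.IsStandardSmoothOfRelativeDimension d) (algebraMap W A)) :
    Algebra.Smooth W A := by
  rw [← RingHom.smooth_algebraMap, RingHom.smooth_iff_locally_isStandardSmooth]
  exact RingHom.locally_of_locally (fun hf => hf.isStandardSmooth) h

theorem rankAtStalk_kaehlerDifferential
    (h : RingHom.Locally (RingHom.IsStandardSmoothOfRelativeDimension d) (algebraMap W A))
    (q : PrimeSpectrum A) : Module.rankAtStalk (R := A) Ω[A⁄W] q = d := by
  have := smooth_of_locally_isStandardSmoothOfRelativeDimension h
  obtain ⟨s, hs, hd⟩ := h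
  obtain ⟨t, ht, htq⟩ : ∃ t ∈ s, t ∉ q.asIdeal := by
    by_contra! hc
    exact q.2.ne_top (top_le_iff.1 (hs ▸ Ideal.span_le.2 hc))
  have hstd := hd t ht
  rw [← IsScalarTower.algebraMap_eq, RingHom.isStandardSmoothOfRelativeDimension_algebraMap] at hstd
  obtain ⟨q', rfl⟩ : q ∈ Set.range (PrimeSpectrum.comap (algebraMap A (Localization.Away t))) := by
    rw [PrimeSpectrum.localization_away_comap_range (Localization.Away t) t]
    exact htq
  have : Algebra.FormallyEtale A (Localization.Away t) := .of_isLocalization (.powers t)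
  have : Nontrivial (Localization.Away t) := q'.nontrivial
  have : Algebra.IsStandardSmooth W (Localization.Away t) := hstd.isStandardSmooth
  rw [← Module.rankAtStalk_isBaseChange
    (KaehlerDifferential.isBaseChange_of_formallyEtale W A (Localization.Away t)),
    Module.rankAtStalk_eq_finrank_of_free]
  exact Module.finrank_eq_of_rank_eq
    (Algebra.IsStandardSmoothOfRelativeDimension.rank_kaehlerDifferential d)

end Coordinates

section HomogeneousCoordinates

open KaehlerDifferential

theorem exists_notMem_forall_smul_mem_of_localized'_eq_top {R M M' : Type*} [CommRing R]
    [AddCommGroup M] [Module R M] [Module.Finite R M] [AddCommGroup M'] [Module R M']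
    (P : Ideal R) [P.IsPrime] [Module (Localization.AtPrime P) M']
    [IsScalarTower R (Localization.AtPrime P) M'] (l : M →ₗ[R] M')
    [IsLocalizedModule P.primeCompl l] {N : Submodule R M}
    (hN : N.localized' (Localization.AtPrime P) P.primeCompl l = ⊤) :
    ∃ g ∉ P, ∀ x, g • x ∈ N := by
  have hsupp : (⟨P, ‹_›⟩ : PrimeSpectrum R) ∉ Module.support R (M ⧸ N) := by
    rw [Module.notMem_support_iff']
    intro x
    obtain ⟨x, rfl⟩ := N.mkQ_surjective x
    obtain ⟨m, hm, s, hs⟩ : l x ∈ N.localized' (Localization.AtPrime P) P.primeCompl l :=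
      hN ▸ Submodule.mem_top
    rw [IsLocalizedModule.mk'_eq_iff, Submonoid.smul_def, ← map_smul,
      IsLocalizedModule.eq_iff_exists P.primeCompl] at hs
    obtain ⟨c, hc⟩ := hs
    refine ⟨c * s, (c * s).2, (Submodule.Quotient.mk_eq_zero N).2 ?_⟩
    change (c * s : R) • x ∈ N
    rw [mul_smul, ← Submonoid.smul_def c, ← hc]
    exact N.smul_mem _ hm
  rw [Module.mem_support_iff_of_finite, SetLike.not_le_iff_exists] at hsupp
  obtain ⟨g, hg, hgP⟩ := hsupp
  refine ⟨g, hgP, fun x => (Submodule.Quotient.mk_eq_zero N).1 ?_⟩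
  rw [← Submodule.mkQ_apply, map_smul, Module.mem_annihilator.1 hg]

theorem decompose_zero_notMem {ι R σ : Type*} [DecidableEq ι] [AddMonoid ι] [Semiring R]
    [SetLike σ R] [AddSubmonoidClass σ R] (𝒜 : ι → σ) [GradedRing 𝒜] {P : Ideal R}
    (hP : ∀ i ≠ 0, ∀ a ∈ 𝒜 i, a ∈ P) {g : R} (hg : g ∉ P) :
    (DirectSum.decompose 𝒜 g 0 : R) ∉ P := by
  classical
  contrapose! hg
  rw [← DirectSum.sum_support_decompose 𝒜 g]
  refine sum_mem fun i _ => ?_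
  obtain rfl | hi := eq_or_ne i 0
  · exact hg
  · exact hP i hi _ (SetLike.coe_mem _)

variable {ι W A : Type*} [AddCommGroup ι] [DecidableEq ι] [CommRing W] [CommRing A] [Algebra W A]
  (𝒜 : ι → Submodule W A) [GradedAlgebra 𝒜] {d : ℕ}

theorem span_range_map_D_homogeneous (L : Type*) [CommRing L] [Algebra A L] [Algebra W L]
    [IsScalarTower W A L] (M : Submonoid A) [IsLocalization M L] :
    Submodule.span L (Set.range fun a : {a : A // SetLike.IsHomogeneousElem 𝒜 a} =>
      KaehlerDifferential.map W W A L (D W A a)) = ⊤ := by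
  rw [eq_top_iff, ← span_range_map_derivation_of_isLocalization W A L M, Submodule.span_le]
  rintro _ ⟨y, rfl⟩
  rw [SetLike.mem_coe, Function.comp_apply]
  induction y using DirectSum.Decomposition.inductionOn 𝒜 with
  | zero => simp only [map_zero, zero_mem]
  | @homogeneous i y => exact Submodule.subset_span ⟨⟨y, i, y.2⟩, rfl⟩
  | add y y' hy hy' =>
    rw [map_add, map_add]
    exact add_mem hy hy'

variable [Algebra.FormallySmooth W A] [Algebra.EssFiniteType W A]

theorem finrank_kaehlerDifferential_localizationAtPrime (P : Ideal A) [P.IsPrime] :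
    Module.finrank (Localization.AtPrime P) Ω[Localization.AtPrime P⁄W] =
      Module.rankAtStalk (R := A) Ω[A⁄W] ⟨P, ‹_›⟩ := by
  let L := Localization.AtPrime P
  have : Algebra.FormallyEtale A L := .of_isLocalization P.primeCompl
  have : Algebra.FormallySmooth W L := .comp W A L
  have : Algebra.EssFiniteType W L := .comp W A L
  have : Module.Free L Ω[L⁄W] := Module.free_of_flat_of_isLocalRing
  have hrank := Module.rankAtStalk_isBaseChange
    (KaehlerDifferential.isBaseChange_of_formallyEtale W A L) (IsLocalRing.closedPoint L)
  rw [Module.rankAtStalk_eq_finrank_of_free] at hrank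
  exact hrank.trans (congrArg _ (PrimeSpectrum.ext (IsLocalization.AtPrime.under_maximalIdeal L P)))

theorem exists_basis_eq_map_D_homogeneous (P : Ideal A) [P.IsPrime]
    (hd : Module.rankAtStalk (R := A) Ω[A⁄W] ⟨P, ‹_›⟩ = d) :
    ∃ a : Fin d → A, (∀ j, SetLike.IsHomogeneousElem 𝒜 (a j)) ∧
      ∃ b : Module.Basis (Fin d) (Localization.AtPrime P) Ω[Localization.AtPrime P⁄W],
        ∀ j, b j = KaehlerDifferential.map W W A (Localization.AtPrime P) (D W A (a j)) := by
  let L := Localization.AtPrime P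
  have : Algebra.FormallyEtale A L := .of_isLocalization P.primeCompl
  have : Algebra.FormallySmooth W L := .comp W A L
  have : Algebra.EssFiniteType W L := .comp W A L
  have : Module.FinitePresentation L Ω[L⁄W] := Module.finitePresentation_of_projective L Ω[L⁄W]
  obtain ⟨κ, a, b, hb⟩ :=
    Module.exists_basis_of_span_of_flat _ (span_range_map_D_homogeneous 𝒜 L P.primeCompl)
  have : Finite κ := Module.Finite.finite_basis b
  have hκ : Nat.card κ = d := by
    rw [← Module.finrank_eq_nat_card_basis b, finrank_kaehlerDifferential_localizationAtPrime, hd]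
  let ε : κ ≃ Fin d := Finite.equivFinOfCardEq hκ
  exact ⟨fun j => a (ε.symm j), fun j => (a (ε.symm j)).2, b.reindex ε, fun j => by
    rw [Module.Basis.reindex_apply, hb]⟩

theorem exists_homogeneous_smul_mem_span {P : Ideal A} [P.IsPrime]
    (hP : ∀ i ≠ 0, ∀ a ∈ 𝒜 i, a ∈ P)
    (hd : Module.rankAtStalk (R := A) Ω[A⁄W] ⟨P, ‹_›⟩ = d) :
    ∃ (a : Fin d → A) (f : A), (∀ j, SetLike.IsHomogeneousElem 𝒜 (a j)) ∧ f ∈ 𝒜 0 ∧ f ∉ P ∧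
      ∀ ω : Ω[A⁄W], f • ω ∈ Submodule.span A (Set.range fun j => D W A (a j)) := by
  let L := Localization.AtPrime P
  have : Algebra.FormallyEtale A L := .of_isLocalization P.primeCompl
  obtain ⟨a, ha, b, hb⟩ := exists_basis_eq_map_D_homogeneous 𝒜 P hd
  set N := Submodule.span A (Set.range fun j => D W A (a j)) with hN
  have hNtop : N.localized' L P.primeCompl (KaehlerDifferential.map W W A L) = ⊤ := by
    rw [hN, Submodule.localized'_span, eq_top_iff, ← b.span_eq, Submodule.span_le]
    rintro _ ⟨j, rfl⟩
    exact Submodule.subset_span ⟨_, ⟨j, rfl⟩, (hb j).symm⟩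
  obtain ⟨g, hgP, hg⟩ := exists_notMem_forall_smul_mem_of_localized'_eq_top P _ hNtop
  exact ⟨a, DirectSum.decompose 𝒜 g 0, ha, SetLike.coe_mem _, decompose_zero_notMem 𝒜 hP hgP,
    decompose_zero_smul_mem_span ha hg⟩

end HomogeneousCoordinates

section EtaleCoordinates

open KaehlerDifferential TensorProduct

/-- The morphism of affine schemes given by `c` is formally étale on the open subset `D(t)`. -/
def FormallyEtaleAway {Q B : Type*} [CommRing Q] [CommRing B] (c : Q →+* B) (t : B) : Prop :=
  ((algebraMap B (Localization.Away t)).comp c).FormallyEtale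

variable {W A κ : Type*} [CommRing W] [CommRing A] [Algebra W A] {a : κ → A} {f : A}

theorem smul_eq_zero_of_forall_smul_mem_span {Q : Type*} [CommRing Q] [Algebra W Q] [Algebra Q A]
    [IsScalarTower W Q A] (ha : ∀ j, a j ∈ Set.range (algebraMap Q A))
    (hf : ∀ ω : Ω[A⁄W], f • ω ∈ Submodule.span A (Set.range fun j => D W A (a j))) (ω : Ω[A⁄Q]) :
    f • ω = 0 := by
  obtain ⟨ω, rfl⟩ := KaehlerDifferential.map_surjective W Q A ω
  have hspan : Submodule.span A (Set.range fun j => D W A (a j)) ≤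
      LinearMap.ker (KaehlerDifferential.map W Q A A) := by
    rw [Submodule.span_le]
    rintro _ ⟨j, rfl⟩
    obtain ⟨q, hq⟩ := ha j
    rw [SetLike.mem_coe, LinearMap.mem_ker, map_D, Algebra.algebraMap_self_apply, ← hq,
      Derivation.map_algebraMap]
  rw [← map_smul]
  exact hspan (hf ω)

theorem formallyUnramified_of_forall_smul_mem_span {Q L : Type*} [CommRing Q] [Algebra W Q]
    [Algebra Q A] [IsScalarTower W Q A] (ha : ∀ j, a j ∈ Set.range (algebraMap Q A))
    (hf : ∀ ω : Ω[A⁄W], f • ω ∈ Submodule.span A (Set.range fun j => D W A (a j)))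
    [CommRing L] [Algebra A L] [Algebra Q L] [IsScalarTower Q A L] [IsLocalization.Away f L] :
    Algebra.FormallyUnramified Q L := by
  rw [Algebra.formallyUnramified_iff]
  refine Submodule.subsingleton_iff L |>.1 (subsingleton_of_bot_eq_top ?_)
  rw [eq_comm, eq_bot_iff, ← span_range_map_derivation_of_isLocalization Q A L (.powers f),
    Submodule.span_le]
  rintro _ ⟨y, rfl⟩
  have hu : IsUnit (algebraMap A L f) := IsLocalization.Away.algebraMap_isUnit f
  rw [SetLike.mem_coe, ← Submodule.smul_mem_iff_of_isUnit _ hu, algebraMap_smul,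
    Function.comp_apply, ← map_smul, smul_eq_zero_of_forall_smul_mem_span ha hf, map_zero]
  exact zero_mem _

theorem formallyEtaleAway_aeval_of_smul_mem_span [Algebra.FormallySmooth W A]
    [Algebra.EssFiniteType W A] [Finite κ]
    (hd : ∀ q, Module.rankAtStalk (R := A) Ω[A⁄W] q = Nat.card κ)
    (hf : ∀ ω : Ω[A⁄W], f • ω ∈ Submodule.span A (Set.range fun j => D W A (a j))) :
    FormallyEtaleAway (MvPolynomial.aeval (R := W) a).toRingHom f := by
  let L := Localization.Away f
  let Q := MvPolynomial κ W
  let : Algebra Q A := (MvPolynomial.aeval (R := W) a).toRingHom.toAlgebra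
  have : IsScalarTower W Q A :=
    .of_algebraMap_eq' (MvPolynomial.aeval (R := W) a).comp_algebraMap.symm
  have : Algebra.FormallyEtale A L := .of_isLocalization (.powers f)
  have : Algebra.FormallySmooth W L := .comp W A L
  have hbc := KaehlerDifferential.isBaseChange_of_formallyEtale W A L
  have : Module.Finite L Ω[L⁄W] := .equiv hbc.equiv
  have : IsScalarTower W Q L := .to₁₂₄ W Q A L
  have : Algebra.FormallyUnramified Q L := formallyUnramified_of_forall_smul_mem_span
    (fun j => ⟨MvPolynomial.X j, MvPolynomial.aeval_X a j⟩) hf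
  have hsurj : Function.Surjective (mapBaseChange W Q L) := fun ω =>
    (exact_mapBaseChange_map W Q L ω).1 (Subsingleton.elim _ _)
  rw [FormallyEtaleAway, ← RingHom.algebraMap_toAlgebra (MvPolynomial.aeval (R := W) a).toRingHom,
    ← IsScalarTower.algebraMap_eq Q A L, RingHom.formallyEtale_algebraMap]
  refine formallyEtale_of_mapBaseChange_bijective (R := W)
    (Module.bijective_of_surjective_of_rankAtStalk_eq hsurj fun m _ => ?_)
  have : Nontrivial L := PrimeSpectrum.nontrivial ⟨m, inferInstance⟩
  rw [Module.rankAtStalk_isBaseChange hbc, hd, Module.rankAtStalk_eq_finrank_of_free]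
  exact Module.finrank_eq_nat_card_basis ((mvPolynomialBasis W κ).baseChange L)

end EtaleCoordinates

/-! ### Infinitesimal lifting away from an element -/

section Lifting

theorem existsUnique_ringHom_of_formallyEtale {Q L S S' : Type*} [CommRing Q] [CommRing L]
    [CommRing S] [CommRing S'] {φ : Q →+* L} (hφ : φ.FormallyEtale) {π : S →+* S'}
    (hπ : Function.Surjective π) (hker : RingHom.ker π ^ 2 = ⊥) {α : Q →+* S} {β : L →+* S'}
    (h : π.comp α = β.comp φ) : ∃! γ : L →+* S, γ.comp φ = α ∧ π.comp γ = β := by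
  algebraize [φ, α, π.comp α]
  let β' : L →ₐ[Q] S' := { β with commutes' := fun x => (RingHom.congr_fun h x).symm }
  let π' : S →ₐ[Q] S' := { π with commutes' := fun _ => rfl }
  have hker' : IsNilpotent (RingHom.ker (π' : S →+* S')) := ⟨2, hker⟩
  let γ := Algebra.FormallySmooth.liftOfSurjective β' π' hπ hker'
  have hγ : π'.comp γ = β' := Algebra.FormallySmooth.comp_liftOfSurjective β' π' hπ hker'
  refine ⟨γ.toRingHom, ⟨γ.comp_algebraMap, congrArg AlgHom.toRingHom hγ⟩, ?_⟩
  rintro δ ⟨hδ, hδβ⟩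
  let δ' : L →ₐ[Q] S := { δ with commutes' := RingHom.congr_fun hδ }
  have hδγ : δ' = γ := Algebra.FormallyUnramified.ext' π ⟨2, hker⟩ δ' γ fun x =>
    (RingHom.congr_fun hδβ x).trans (AlgHom.congr_fun hγ x).symm
  exact congrArg AlgHom.toRingHom hδγ

theorem formallyEtale_of_existsUnique {Q L : Type u} [CommRing Q] [CommRing L] {φ : Q →+* L}
    (h : ∀ (S : Type u) [CommRing S] (I : Ideal S), I ^ 2 = ⊥ → ∀ (α : Q →+* S) (β : L →+* S ⧸ I),
      (Ideal.Quotient.mk I).comp α = β.comp φ →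
      ∃! γ : L →+* S, γ.comp φ = α ∧ (Ideal.Quotient.mk I).comp γ = β) : φ.FormallyEtale := by
  algebraize [φ]
  change Algebra.FormallyEtale Q L
  rw [Algebra.FormallyEtale.iff_comp_bijective]
  refine fun S _ _ I hI => (Function.bijective_iff_existsUnique _).2 fun β => ?_
  obtain ⟨γ, ⟨hα, hβ⟩, huniq⟩ := h S I hI (algebraMap Q S) β.toRingHom β.comp_algebraMap.symm
  refine ⟨{ γ with commutes' := RingHom.congr_fun hα }, AlgHom.ext (RingHom.congr_fun hβ), ?_⟩
  exact fun δ hδ => AlgHom.coe_ringHom_injective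
    (huniq δ.toRingHom ⟨δ.comp_algebraMap, congrArg AlgHom.toRingHom hδ⟩)

theorem FormallyEtaleAway.existsUnique_ringHom {Q B S S' : Type*} [CommRing Q] [CommRing B]
    [CommRing S] [CommRing S'] {c : Q →+* B} {t : B} (h : FormallyEtaleAway c t) {π : S →+* S'}
    (hπ : Function.Surjective π) (hker : RingHom.ker π ^ 2 = ⊥) {α : Q →+* S} {β : B →+* S'}
    (ht : IsUnit (β t)) (hαβ : π.comp α = β.comp c) :
    ∃! γ : B →+* S, γ.comp c = α ∧ π.comp γ = β := by
  let L := Localization.Away t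
  have hβ : (IsLocalization.Away.lift (S := L) t ht).comp (algebraMap B L) = β :=
    IsLocalization.Away.lift_comp t ht
  obtain ⟨γ, ⟨hγc, hγβ⟩, huniq⟩ := existsUnique_ringHom_of_formallyEtale h hπ hker
    (β := IsLocalization.Away.lift (S := L) t ht) (α := α)
    (by rw [← RingHom.comp_assoc, hβ, hαβ])
  refine ⟨γ.comp (algebraMap B L), ⟨hγc, by rw [← RingHom.comp_assoc, hγβ, hβ]⟩, ?_⟩
  rintro δ ⟨hδc, hδβ⟩
  have hδt : IsUnit (δ t) :=
    isUnit_of_isUnit_map_of_ker_sq hπ hker (by rwa [← RingHom.comp_apply, hδβ])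
  have hδ : (IsLocalization.Away.lift (S := L) t hδt).comp (algebraMap B L) = δ :=
    IsLocalization.Away.lift_comp t hδt
  rw [← huniq (IsLocalization.Away.lift (S := L) t hδt)
    ⟨by rw [← RingHom.comp_assoc, hδ, hδc], IsLocalization.ringHom_ext (.powers t) ?_⟩, hδ]
  rw [RingHom.comp_assoc, hδ, hβ, hδβ]

theorem formallyEtaleAway_of_existsUnique_ringHom {Q B : Type u} [CommRing Q] [CommRing B]
    {c : Q →+* B} {t : B}
    (h : ∀ (S : Type u) [CommRing S] (I : Ideal S), I ^ 2 = ⊥ → ∀ (α : Q →+* S) (β : B →+* S ⧸ I),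
      IsUnit (β t) → (Ideal.Quotient.mk I).comp α = β.comp c →
      ∃! γ : B →+* S, γ.comp c = α ∧ (Ideal.Quotient.mk I).comp γ = β) :
    FormallyEtaleAway c t := by
  let L := Localization.Away t
  refine formallyEtale_of_existsUnique fun S _ I hI α β hαβ => ?_
  have hβt : IsUnit (β.comp (algebraMap B L) t) :=
    (IsLocalization.Away.algebraMap_isUnit (S := L) t).map β
  obtain ⟨γ, ⟨hγc, hγβ⟩, huniq⟩ := h S I hI α (β.comp (algebraMap B L)) hβt hαβ
  have hγt : IsUnit (γ t) := isUnit_of_isUnit_map_of_ker_sq (Ideal.Quotient.mk_surjective (I := I))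
    (by rwa [Ideal.mk_ker]) (by rwa [← RingHom.comp_apply, hγβ])
  have hγ : (IsLocalization.Away.lift (S := L) t hγt).comp (algebraMap B L) = γ :=
    IsLocalization.Away.lift_comp t hγt
  refine ⟨IsLocalization.Away.lift (S := L) t hγt,
    ⟨by rw [← RingHom.comp_assoc, hγ, hγc], IsLocalization.ringHom_ext (.powers t) ?_⟩, ?_⟩
  · rw [RingHom.comp_assoc, hγ, hγβ]
  · rintro δ ⟨hδc, hδβ⟩
    refine IsLocalization.ringHom_ext (.powers t) ?_
    rw [hγ]
    exact huniq _ ⟨hδc, by rw [← RingHom.comp_assoc, hδβ]⟩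

theorem FormallyEtaleAway.existsUnique_algHom {W A S S' κ : Type*} [CommRing W] [CommRing A]
    [Algebra W A] [CommRing S] [Algebra W S] [CommRing S'] [Algebra W S'] {a : κ → A} {f : A}
    (h : FormallyEtaleAway (MvPolynomial.aeval (R := W) a).toRingHom f) {π : S →ₐ[W] S'}
    (hπ : Function.Surjective π) (hker : RingHom.ker π ^ 2 = ⊥) {φ : A →ₐ[W] S'}
    (hφ : IsUnit (φ f)) {s : κ → S} (hs : ∀ j, π (s j) = φ (a j)) :
    ∃! ψ : A →ₐ[W] S, π.comp ψ = φ ∧ ∀ j, ψ (a j) = s j := by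
  have hcomp : π.comp (MvPolynomial.aeval s) = φ.comp (MvPolynomial.aeval (R := W) a) :=
    MvPolynomial.algHom_ext fun j => by
      rw [AlgHom.comp_apply, AlgHom.comp_apply, MvPolynomial.aeval_X, MvPolynomial.aeval_X, hs]
  obtain ⟨γ, ⟨hγ, hγφ⟩, huniq⟩ := h.existsUnique_ringHom (π := π.toRingHom) (β := φ.toRingHom) hπ
    hker hφ (congrArg AlgHom.toRingHom hcomp)
  refine ⟨{ γ with commutes' := fun w => ?_ },
    ⟨AlgHom.ext (RingHom.congr_fun hγφ), fun j => ?_⟩, ?_⟩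
  · exact (congrArg γ (MvPolynomial.aeval_C a w)).symm.trans
      ((RingHom.congr_fun hγ (MvPolynomial.C w)).trans (MvPolynomial.aeval_C s w))
  · exact (congrArg γ (MvPolynomial.aeval_X a j)).symm.trans
      ((RingHom.congr_fun hγ (MvPolynomial.X j)).trans (MvPolynomial.aeval_X s j))
  · rintro δ ⟨hδφ, hδ⟩
    refine AlgHom.coe_ringHom_injective
      (huniq δ.toRingHom ⟨?_, congrArg AlgHom.toRingHom hδφ⟩)
    have hδX : δ.comp (MvPolynomial.aeval (R := W) a) = MvPolynomial.aeval s :=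
      MvPolynomial.algHom_ext fun j => by
        rw [AlgHom.comp_apply, MvPolynomial.aeval_X, MvPolynomial.aeval_X, hδ]
    exact congrArg AlgHom.toRingHom hδX

theorem formallyEtaleAway_aeval_of_existsUnique {κ : Type} {W A : Type u} [CommRing W] [CommRing A]
    [Algebra W A] {a : κ → A} {f : A}
    (h : ∀ (S : Type u) [CommRing S] [Algebra W S] (I : Ideal S), I ^ 2 = ⊥ →
      ∀ φ : A →ₐ[W] S ⧸ I, IsUnit (φ f) → ∀ s : κ → S, (∀ j, Ideal.Quotient.mk I (s j) = φ (a j)) →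
      ∃! ψ : A →ₐ[W] S, (Ideal.Quotient.mkₐ W I).comp ψ = φ ∧ ∀ j, ψ (a j) = s j) :
    FormallyEtaleAway (MvPolynomial.aeval (R := W) a).toRingHom f := by
  refine formallyEtaleAway_of_existsUnique_ringHom fun S _ I hI α β hβ hαβ => ?_
  let : Algebra W S := (α.comp MvPolynomial.C).toAlgebra
  let φ : A →ₐ[W] S ⧸ I := { β with
    commutes' := fun w => (congrArg β (MvPolynomial.aeval_C a w)).symm.trans
      (RingHom.congr_fun hαβ (MvPolynomial.C w)).symm }
  obtain ⟨ψ, ⟨hψφ, hψ⟩, huniq⟩ := h S I hI φ hβ (fun j => α (MvPolynomial.X j)) fun j =>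
    (RingHom.congr_fun hαβ (MvPolynomial.X j)).trans (congrArg β (MvPolynomial.aeval_X a j))
  refine ⟨ψ.toRingHom, ⟨MvPolynomial.ringHom_ext (fun w => ?_) fun j => ?_,
    congrArg AlgHom.toRingHom hψφ⟩, ?_⟩
  · exact (congrArg ψ (MvPolynomial.aeval_C a w)).trans (ψ.commutes w)
  · exact (congrArg ψ (MvPolynomial.aeval_X a j)).trans (hψ j)
  · rintro δ ⟨hδ, hδβ⟩
    let δ' : A →ₐ[W] S := { δ with
      commutes' := fun w => (congrArg δ (MvPolynomial.aeval_C a w)).symm.trans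
        (RingHom.congr_fun hδ (MvPolynomial.C w)) }
    have hδ' (j : κ) : δ' (a j) = α (MvPolynomial.X j) :=
      (congrArg δ (MvPolynomial.aeval_X a j)).symm.trans
        (RingHom.congr_fun hδ (MvPolynomial.X j))
    exact congrArg AlgHom.toRingHom (huniq δ' ⟨AlgHom.ext (RingHom.congr_fun hδβ), hδ'⟩)

end Lifting

section GradedLifting

variable {ι W A S S' : Type*} [DecidableEq ι] [AddCancelMonoid ι] [CommRing W] [CommRing A]
  [CommRing S] [CommRing S'] [Algebra W A] [Algebra W S] [Algebra W S']
  {𝒜 : ι → Submodule W A} [GradedAlgebra 𝒜] {𝒮 : ι → Submodule W S} [GradedAlgebra 𝒮]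
  {𝒮' : ι → Submodule W S'} [GradedAlgebra 𝒮'] {π : 𝒮 →ₐᵍ[W] 𝒮'}

theorem exists_gradedAlgHom_comp_eq [Algebra.FormallySmooth W A] (hπ : Function.Surjective π)
    (hker : RingHom.ker π ^ 2 = ⊥) (φ : 𝒜 →ₐᵍ[W] 𝒮') : ∃ ψ : 𝒜 →ₐᵍ[W] 𝒮, π.comp ψ = φ := by
  obtain ⟨ψ, -, hψ⟩ := exists_gradedAlgHom_of_comp_eq (𝒮 := 𝒮) (π := π) (φ := φ) hker
    (g := Algebra.FormallySmooth.liftOfSurjective (φ : A →ₐ[W] S') (π : S →ₐ[W] S') hπ ⟨2, hker⟩)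
    (Algebra.FormallySmooth.liftOfSurjective_apply _ _ hπ ⟨2, hker⟩)
  exact ⟨ψ, GradedAlgHom.ext hψ⟩

theorem FormallyEtaleAway.existsUnique_gradedAlgHom {κ : Type*} {a : κ → A} {f : A}
    (h : FormallyEtaleAway (MvPolynomial.aeval (R := W) a).toRingHom f)
    (hπ : Function.Surjective π) (hker : RingHom.ker π ^ 2 = ⊥) {φ : 𝒜 →ₐᵍ[W] 𝒮'}
    (hφ : IsUnit (φ f)) {e : κ → ι} (ha : ∀ j, a j ∈ 𝒜 (e j)) {s : κ → S}
    (hs : ∀ j, s j ∈ 𝒮 (e j)) (hsφ : ∀ j, π (s j) = φ (a j)) :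
    ∃! ψ : 𝒜 →ₐᵍ[W] 𝒮, π.comp ψ = φ ∧ ∀ j, ψ (a j) = s j := by
  obtain ⟨g, ⟨hgφ, hg⟩, huniq⟩ := h.existsUnique_algHom (π := (π : S →ₐ[W] S'))
    (φ := (φ : A →ₐ[W] S')) hπ hker hφ hsφ
  obtain ⟨ψ, hψ, hψφ⟩ := exists_gradedAlgHom_of_comp_eq (𝒮 := 𝒮) hker (AlgHom.congr_fun hgφ)
  have hψs (j : κ) : ψ (a j) = s j := by
    rw [hψ _ _ (ha j), hg, DirectSum.decompose_of_mem_same 𝒮 (hs j)]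
  have hψg : (ψ : A →ₐ[W] S) = g := huniq ψ ⟨AlgHom.ext hψφ, hψs⟩
  refine ⟨ψ, ⟨GradedAlgHom.ext hψφ, hψs⟩, fun ψ' hψ' => GradedAlgHom.coe_toAlgHom_injective ?_⟩
  exact (huniq ψ' ⟨AlgHom.ext fun x => DFunLike.congr_fun hψ'.1 x, hψ'.2⟩).trans hψg.symm

end GradedLifting

/-! ### Representability of the functor of graded points -/

section HomogeneousGenerators

variable {ι W A B σ : Type*} [DecidableEq ι] [AddCommMonoid ι] [CommRing W] [CommRing A]
  [Algebra W A] [CommRing B] [Algebra W B] {𝒜 : ι → Submodule W A} [GradedAlgebra 𝒜]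
  {ℬ : ι → Submodule W B} [GradedAlgebra ℬ]

attribute [local instance] MvPolynomial.weightedGradedAlgebra

/-- Evaluation of polynomials, weighted by `e`, at homogeneous elements of degrees `e`. -/
noncomputable def gradedAeval {e : σ → ι} {a : σ → A} (ha : ∀ j, a j ∈ 𝒜 (e j)) :
    MvPolynomial.weightedHomogeneousSubmodule W e →ₐᵍ[W] 𝒜 where
  toAlgHom := MvPolynomial.aeval a
  map_mem {i x} hx := by
    change MvPolynomial.aeval a x ∈ 𝒜 i
    rw [MvPolynomial.aeval_def, MvPolynomial.eval₂_eq]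
    refine sum_mem fun d hd => ?_
    rw [← Algebra.smul_def, ← hx (MvPolynomial.mem_support_iff.1 hd), Finsupp.weight_apply]
    exact Submodule.smul_mem _ _ (SetLike.prod_pow_mem_graded 𝒜 e a d fun j _ => ha j)

theorem exists_gradedAeval_surjective {ι : Type v} {A : Type u} [DecidableEq ι] [AddCommMonoid ι]
    [CommRing A] [Algebra W A] [Algebra.FiniteType W A] (𝒜 : ι → Submodule W A)
    [GradedAlgebra 𝒜] :
    ∃ (σ : Type (max u v)) (_ : Finite σ) (e : σ → ι) (a : σ → A) (ha : ∀ j, a j ∈ 𝒜 (e j)),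
      Function.Surjective (gradedAeval ha) := by
  classical
  obtain ⟨F, hF⟩ := Algebra.FiniteType.out (R := W) (A := A)
  let a (j : Σ x : F, (DirectSum.decompose 𝒜 x.1).support) : A := DirectSum.decompose 𝒜 j.1.1 j.2
  refine ⟨_, inferInstance, fun j => j.2, a, fun j => SetLike.coe_mem _, ?_⟩
  change Function.Surjective (MvPolynomial.aeval a)
  rw [← AlgHom.range_eq_top, ← Algebra.adjoin_range_eq_range_aeval, ← top_le_iff, ← hF,
    Algebra.adjoin_le_iff]
  intro x hx
  rw [SetLike.mem_coe, ← DirectSum.sum_support_decompose 𝒜 x]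
  exact sum_mem fun i hi => Algebra.subset_adjoin ⟨⟨⟨x, hx⟩, i, hi⟩, rfl⟩

theorem exists_gradedAlgHom_comp_eq_of_ker_le {C : Type*} [CommRing C] [Algebra W C]
    {𝒞 : ι → Submodule W C} [GradedAlgebra 𝒞] {π : 𝒞 →ₐᵍ[W] 𝒜} (hπ : Function.Surjective π)
    (φ : 𝒞 →ₐᵍ[W] ℬ) (hφ : RingHom.ker π ≤ RingHom.ker φ) : ∃ ψ : 𝒜 →ₐᵍ[W] ℬ, ψ.comp π = φ := by
  let ψ : A →ₐ[W] B := AlgHom.liftOfSurjective (π : C →ₐ[W] A) hπ (φ : C →ₐ[W] B) hφ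
  have hψ (x : C) : ψ (π x) = φ x := AlgHom.liftOfSurjective_apply _ hπ _ hφ x
  refine ⟨⟨ψ, fun {i a} ha => ?_⟩, GradedAlgHom.ext hψ⟩
  obtain ⟨x, rfl⟩ := hπ a
  change ψ (π x) ∈ ℬ i
  rw [← DirectSum.decompose_of_mem_same 𝒜 ha, ← map_directSumDecompose, hψ]
  exact GradedFunLike.map_mem φ (SetLike.coe_mem _)

end HomogeneousGenerators

namespace TruncWittFrame

variable {p : ℕ} [Fact p.Prime] {n : ℕ} {k : Type*} [Field k] [CharP k p]
  {R R' : Type*} [CommRing R] [Algebra k R] [CommRing R'] [Algebra k R']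

/-- The functoriality map `map` as a homomorphism of graded algebras. -/
noncomputable def gradedMap (p n : ℕ) [Fact p.Prime] {k : Type*} [Field k] [CharP k p]
    {R R' : Type*} [CommRing R] [Algebra k R] [CommRing R'] [Algebra k R'] (f : R →ₐ[k] R') :
    grading p n k R →ₐᵍ[WittVector p k] grading p n k R' :=
  ⟨map f, map_mem_grading f⟩

theorem gradedMap_comp_gradedMap {R'' : Type*} [CommRing R''] [Algebra k R''] (g : R' →ₐ[k] R'')
    (f : R →ₐ[k] R') : (gradedMap p n g).comp (gradedMap p n f) = gradedMap p n (g.comp f) :=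
  GradedAlgHom.ext (map_map f g)

/-- The reduction map `reduction` as a homomorphism of graded algebras. -/
noncomputable def gradedReduction (p : ℕ) [Fact p.Prime] {m : ℕ} (h : n ≤ m) (k R : Type*)
    [Field k] [CharP k p] [CommRing R] [Algebra k R] :
    grading p m k R →ₐᵍ[WittVector p k] grading p n k R :=
  ⟨reduction h R, reduction_mem_grading h⟩

theorem gradedReduction_comp_gradedMap {m : ℕ} (h : n ≤ m) (f : R →ₐ[k] R') :
    (gradedReduction p h k R').comp (gradedMap p m f) =
      (gradedMap p n f).comp (gradedReduction p h k R) :=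
  GradedAlgHom.ext (reduction_map h f)

theorem eq_of_coord_eq {i : ℤ} {x y : TruncWittFrame p n k R} (hx : x ∈ grading p n k R i)
    (hy : y ∈ grading p n k R i) (h : coord p n k R i x = coord p n k R i y) : x = y := by
  rw [← incl_coord_of_mem hx, h, incl_coord_of_mem hy]

/-- The ideal generated by the Witt coefficients of the components of the elements of `T`: the
elements of `T` vanish in `S` precisely over the vanishing locus of this ideal. -/
def coeffIdeal (T : Set (TruncWittFrame p n k R)) : Ideal R :=
  Ideal.span {c | ∃ x ∈ T, ∃ i m, c = (coord p n k R i x).coeff m}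

theorem coeffIdeal_le_ker_iff (g : R →ₐ[k] R') (T : Set (TruncWittFrame p n k R)) :
    coeffIdeal T ≤ RingHom.ker g ↔ ∀ x ∈ T, map g x = 0 := by
  rw [coeffIdeal, Ideal.span_le]
  refine ⟨fun h x hx => ext_coord fun i => TruncatedWittVector.ext fun m => ?_, ?_⟩
  · rw [coeff_coord_map, map_zero, TruncatedWittVector.coeff_zero]
    exact h ⟨x, hx, i, m, rfl⟩
  · rintro h _ ⟨x, hx, i, m, rfl⟩
    rw [SetLike.mem_coe, RingHom.mem_ker, ← coeff_coord_map, h x hx, map_zero,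
      TruncatedWittVector.coeff_zero]

end TruncWittFrame

section Universal

open TruncWittFrame

variable {p : ℕ} [Fact p.Prime] {n : ℕ} {k : Type u} [Field k] [CharP k p]

/-- A graded point `U` of `A` over `B` is universal if every graded point over a `k`-algebra `R` is
the image of `U` under a unique homomorphism `B → R`, that is, if `B` represents the functor of
graded points. -/
def IsUniversal {A : Type*} [CommRing A] [Algebra (WittVector p k) A]
    {𝒜 : ℤ → Submodule (WittVector p k) A} [GradedAlgebra 𝒜] {B : Type u} [CommRing B] [Algebra k B]
    (U : 𝒜 →ₐᵍ[WittVector p k] grading p n k B) : Prop :=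
  ∀ (R : Type u) [CommRing R] [Algebra k R],
    Function.Bijective fun g : B →ₐ[k] R => (gradedMap p n g).comp U

attribute [local instance] MvPolynomial.weightedGradedAlgebra

/-- The graded point of an affine space, with weights `e`, whose Witt coefficients are
indeterminates. -/
noncomputable def genericGradedPoint (p n : ℕ) [Fact p.Prime] (k : Type u) [Field k] [CharP k p]
    {σ : Type*} (e : σ → ℤ) : MvPolynomial.weightedHomogeneousSubmodule (WittVector p k) e
      →ₐᵍ[WittVector p k] grading p n k (MvPolynomial (σ × Fin n) k) :=
  gradedAeval (a := fun j => incl p n k _ (e j) (TruncatedWittVector.mk p fun m =>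
    MvPolynomial.X (j, m))) fun j => incl_mem_grading (e j) _

theorem coeff_coord_gradedMap_genericGradedPoint {σ : Type*} (e : σ → ℤ) {R : Type*} [CommRing R]
    [Algebra k R] (g : MvPolynomial (σ × Fin n) k →ₐ[k] R) (x : σ × Fin n) :
    (coord p n k R (e x.1) (gradedMap p n g (genericGradedPoint p n k e
      (MvPolynomial.X x.1)))).coeff x.2 = g (MvPolynomial.X x) := by
  have hX : genericGradedPoint p n k e (MvPolynomial.X x.1) = incl p n k _ (e x.1)
      (TruncatedWittVector.mk p fun m => MvPolynomial.X (x.1, m)) := MvPolynomial.aeval_X _ _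
  refine (coeff_coord_map g (e x.1) _ x.2).trans ?_
  rw [hX, coord_incl_self, TruncatedWittVector.coeff_mk]

theorem isUniversal_genericGradedPoint {σ : Type u} (e : σ → ℤ) :
    IsUniversal (genericGradedPoint p n k e) := by
  refine fun R _ _ => ⟨fun g g' h => MvPolynomial.algHom_ext fun x => ?_, fun φ => ?_⟩
  · rw [← coeff_coord_gradedMap_genericGradedPoint (p := p) e,
      ← coeff_coord_gradedMap_genericGradedPoint (p := p) e]
    exact congrArg (fun ψ => (coord p n k R (e x.1) (ψ (MvPolynomial.X x.1))).coeff x.2) h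
  · refine ⟨MvPolynomial.aeval fun x =>
      (coord p n k R (e x.1) (φ (MvPolynomial.X x.1))).coeff x.2, ?_⟩
    refine GradedAlgHom.coe_toAlgHom_injective (MvPolynomial.algHom_ext fun j => ?_)
    have hX : MvPolynomial.X j ∈
        MvPolynomial.weightedHomogeneousSubmodule (WittVector p k) e (e j) :=
      MvPolynomial.isWeightedHomogeneous_X _ e j
    refine eq_of_coord_eq (GradedFunLike.map_mem ((gradedMap p n _).comp _) hX)
      (GradedFunLike.map_mem φ hX) (TruncatedWittVector.ext fun m => ?_)
    exact (coeff_coord_gradedMap_genericGradedPoint e _ (j, m)).trans (MvPolynomial.aeval_X _ _)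

theorem IsUniversal.exists_isUniversal_quotient {C A : Type*} [CommRing C]
    [Algebra (WittVector p k) C] [CommRing A] [Algebra (WittVector p k) A]
    {𝒞 : ℤ → Submodule (WittVector p k) C} [GradedAlgebra 𝒞]
    {𝒜 : ℤ → Submodule (WittVector p k) A} [GradedAlgebra 𝒜] {B : Type u} [CommRing B]
    [Algebra k B] {V : 𝒞 →ₐᵍ[WittVector p k] grading p n k B} (hV : IsUniversal V)
    {π : 𝒞 →ₐᵍ[WittVector p k] 𝒜} (hπ : Function.Surjective π) :
    ∃ U : 𝒜 →ₐᵍ[WittVector p k] grading p n k (B ⧸ coeffIdeal (V '' RingHom.ker π)),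
      IsUniversal U := by
  let J := coeffIdeal (V '' RingHom.ker π)
  let q : B →ₐ[k] B ⧸ J := Ideal.Quotient.mkₐ k J
  have hq : ∀ x ∈ RingHom.ker π, map q (V x) = 0 := fun x hx =>
    (coeffIdeal_le_ker_iff q _).1 (Ideal.mk_ker (I := J)).ge _ ⟨x, hx, rfl⟩
  obtain ⟨U, hU⟩ := exists_gradedAlgHom_comp_eq_of_ker_le hπ ((gradedMap p n q).comp V) hq
  have hUg {R : Type u} [CommRing R] [Algebra k R] (g : B ⧸ J →ₐ[k] R) :
      ((gradedMap p n g).comp U).comp π = (gradedMap p n (g.comp q)).comp V := by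
    rw [GradedAlgHom.comp_assoc, hU, ← GradedAlgHom.comp_assoc, gradedMap_comp_gradedMap]
  refine ⟨U, fun R _ _ => ⟨fun g g' h => ?_, fun φ => ?_⟩⟩
  · refine Ideal.Quotient.algHom_ext k ((hV R).1 ?_)
    exact (hUg g).symm.trans ((congrArg (·.comp π) h).trans (hUg g'))
  · obtain ⟨g, hg⟩ := (hV R).2 (φ.comp π)
    have hJ : J ≤ RingHom.ker g := by
      rw [coeffIdeal_le_ker_iff]
      rintro _ ⟨x, hx, rfl⟩
      refine (DFunLike.congr_fun hg x).trans ?_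
      rw [GradedAlgHom.comp_apply, RingHom.mem_ker.1 hx, map_zero]
    refine ⟨Ideal.Quotient.liftₐ J g fun a ha => hJ ha, (GradedAlgHom.cancel_right hπ).1 ?_⟩
    exact (hUg _).trans hg

variable {A : Type u} [CommRing A] [Algebra (WittVector p k) A]
  {𝒜 : ℤ → Submodule (WittVector p k) A} [GradedAlgebra 𝒜]

variable (𝒜 n) in
theorem exists_isUniversal [Algebra.FiniteType (WittVector p k) A] :
    ∃ (B : Type u) (_ : CommRing B) (_ : Algebra k B) (_ : Algebra.FiniteType k B)
      (U : 𝒜 →ₐᵍ[WittVector p k] grading p n k B), IsUniversal U := by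
  obtain ⟨σ, _, e, a, ha, hsurj⟩ := exists_gradedAeval_surjective 𝒜
  obtain ⟨U, hU⟩ := (isUniversal_genericGradedPoint e).exists_isUniversal_quotient (n := n) hsurj
  exact ⟨_, inferInstance, inferInstance, inferInstance, U, hU⟩

/-- Graded points in the sense of `GradedPoints` are homomorphisms of graded algebras. -/
noncomputable def GradedPoints.equiv (R : Type u) [CommRing R] [Algebra k R] :
    GradedPoints p 𝒜 n R ≃ (𝒜 →ₐᵍ[WittVector p k] grading p n k R) where
  toFun φ := ⟨φ.1, fun {i} _ ha => φ.2 i _ ha⟩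
  invFun φ := ⟨φ, fun _ _ ha => GradedFunLike.map_mem φ ha⟩
  left_inv _ := rfl
  right_inv _ := rfl

/-- The corepresentation of the functor of graded points by a universal graded point. -/
noncomputable def IsUniversal.corepresentableBy {B : Type u} [CommRing B] [Algebra k B]
    {U : 𝒜 →ₐᵍ[WittVector p k] grading p n k B} (hU : IsUniversal U) :
    (gradedPointsFunctor p 𝒜 n).CorepresentableBy (CommAlgCat.of k B) where
  homEquiv {R} := (ConcreteCategory.homEquiv.trans (.ofBijective _ (hU R))).trans
    (GradedPoints.equiv R).symm
  homEquiv_comp g f := Subtype.ext (AlgHom.ext fun _ => (TruncWittFrame.map_map f.hom g.hom _).symm)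

/-- The graded point over a representing algebra that corresponds to the identity. -/
noncomputable def universalPoint {B : CommAlgCat.{u} k}
    (h : (gradedPointsFunctor p 𝒜 n).CorepresentableBy B) :
    𝒜 →ₐᵍ[WittVector p k] grading p n k B :=
  GradedPoints.equiv B (h.homEquiv (𝟙 B))

theorem isUniversal_universalPoint {B : CommAlgCat.{u} k}
    (h : (gradedPointsFunctor p 𝒜 n).CorepresentableBy B) : IsUniversal (universalPoint h) := by
  intro R _ _
  have heq : (fun g : B →ₐ[k] R => (gradedMap p n g).comp (universalPoint h)) =
      GradedPoints.equiv R ∘ h.homEquiv ∘ CommAlgCat.ofHom := funext fun g =>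
    congrArg (GradedPoints.equiv R) (h.homEquiv_eq (CommAlgCat.ofHom g)).symm
  rw [heq]
  exact (GradedPoints.equiv R).bijective.comp
    (h.homEquiv.bijective.comp
    ⟨fun _ _ hg => congrArg CommAlgCat.Hom.hom hg, fun g => ⟨g.hom, rfl⟩⟩)

theorem gradedMap_representingHom_comp_universalPoint {B B' : CommAlgCat.{u} k}
    (h : (gradedPointsFunctor p 𝒜 n).CorepresentableBy B)
    (h' : (gradedPointsFunctor p 𝒜 (n + 1)).CorepresentableBy B') :
    (gradedMap p n (representingHom (gradedPointsReduction p 𝒜 n) h h').hom).comp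
      (universalPoint h) = (gradedReduction p n.le_succ k B').comp (universalPoint h') := by
  have hmap : (gradedPointsFunctor p 𝒜 n).map
      (representingHom (gradedPointsReduction p 𝒜 n) h h') (h.homEquiv (𝟙 B)) =
      (gradedPointsReduction p 𝒜 n).app B' (h'.homEquiv (𝟙 B')) := by
    rw [← h.homEquiv_eq, representingHom, Equiv.apply_symm_apply]
  exact congrArg (GradedPoints.equiv B') hmap

theorem finiteType_of_corepresentableBy [Algebra.FiniteType (WittVector p k) A]
    {B : CommAlgCat.{u} k} (h : (gradedPointsFunctor p 𝒜 n).CorepresentableBy B) :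
    Algebra.FiniteType k B := by
  obtain ⟨B₀, _, _, _, U, hU⟩ := exists_isUniversal (k := k) n 𝒜
  exact .equiv inferInstance (CommAlgCat.algEquivOfIso (hU.corepresentableBy.uniqueUpToIso h))

end Universal

/-! ### Étale coordinates on the representing algebra -/

namespace TruncWittFrame

variable {p : ℕ} [Fact p.Prime] {n : ℕ} {k : Type*} [Field k] [CharP k p]
  {R R' : Type*} [CommRing R] [Algebra k R] [CommRing R'] [Algebra k R']

theorem map_eq_incl_mk_iff (g : R →ₐ[k] R') {i : ℤ} {x : TruncWittFrame p n k R}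
    (hx : x ∈ grading p n k R i) (c : Fin n → R') :
    map g x = incl p n k R' i (TruncatedWittVector.mk p c) ↔
      ∀ m, g ((coord p n k R i x).coeff m) = c m := by
  have hcoord (m : Fin n) : (coord p n k R' i (incl p n k R' i
      (TruncatedWittVector.mk p c))).coeff m = c m := by
    rw [coord_incl_self, TruncatedWittVector.coeff_mk]
  refine ⟨fun h m => by rw [← coeff_coord_map, h, hcoord], fun h => ?_⟩
  refine eq_of_coord_eq (map_mem_grading g hx) (incl_mem_grading i _)
    (TruncatedWittVector.ext fun m => ?_)
  rw [coeff_coord_map, h, hcoord]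

end TruncWittFrame

section WittCoordinates

open TruncWittFrame

variable {p : ℕ} [Fact p.Prime] {n : ℕ} {k : Type u} [Field k] [CharP k p]
  {A : Type*} [CommRing A] [Algebra (WittVector p k) A]
  {𝒜 : ℤ → Submodule (WittVector p k) A} [GradedAlgebra 𝒜] {B : Type u} [CommRing B] [Algebra k B]

/-- The Witt coefficients of the values of a graded point at elements of degrees `e`; for a
universal graded point, coordinates `a` on `A` thus give coordinates on the representing algebra. -/
noncomputable def wittCoords {κ : Type*} (U : 𝒜 →ₐᵍ[WittVector p k] grading p n k B) (a : κ → A)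
    (e : κ → ℤ) (x : κ × Fin n) : B :=
  (coord p n k B (e x.1) (U (a x.1))).coeff x.2

theorem IsUniversal.formallyEtaleAway_wittCoords {U : 𝒜 →ₐᵍ[WittVector p k] grading p n k B}
    (hU : IsUniversal U) (hn : 1 ≤ n) {κ : Type} {a : κ → A} {e : κ → ℤ} {f : A}
    (ha : ∀ j, a j ∈ 𝒜 (e j)) (hf : f ∈ 𝒜 0)
    (h : FormallyEtaleAway (MvPolynomial.aeval (R := WittVector p k) a).toRingHom f) :
    FormallyEtaleAway (MvPolynomial.aeval (R := k) (wittCoords U a e)).toRingHom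
      (constantTerm p k B hn (U f)) := by
  refine formallyEtaleAway_aeval_of_existsUnique fun S _ _ I hI φ hφ s hs => ?_
  let q : S →ₐ[k] S ⧸ I := Ideal.Quotient.mkₐ k I
  have hUa (j : κ) : U (a j) ∈ grading p n k B (e j) := GradedFunLike.map_mem U (ha j)
  have hunit : IsUnit (((gradedMap p n φ).comp U) f) :=
    isUnit_of_isUnit_constantTerm hn (GradedFunLike.map_mem ((gradedMap p n φ).comp U) hf)
      (by rwa [← constantTerm_map] at hφ)
  have hs' (j : κ) : gradedMap p n q (incl p n k S (e j) (TruncatedWittVector.mk p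
      fun m => s (j, m))) = ((gradedMap p n φ).comp U) (a j) := by
    refine Eq.trans ?_ ((map_eq_incl_mk_iff φ (hUa j) _).2 fun m => (hs (j, m)).symm).symm
    refine (map_eq_incl_mk_iff q (incl_mem_grading _ _) _).2 fun m => ?_
    rw [coord_incl_self, TruncatedWittVector.coeff_mk]
    rfl
  have hker : RingHom.ker q ^ 2 = ⊥ := (congrArg (· ^ 2) (Ideal.mk_ker (I := I))).trans hI
  have hlift := h.existsUnique_gradedAlgHom (π := gradedMap p n q)
    (map_surjective (Ideal.Quotient.mkₐ_surjective k I)) (ker_map_sq hker) hunit ha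
    (fun j => incl_mem_grading (e j) _) hs'
  refine (existsUnique_congr fun g => ?_).1 (((hU S).existsUnique_iff).1 hlift)
  have hφ_iff : (gradedMap p n q).comp ((gradedMap p n g).comp U) = (gradedMap p n φ).comp U ↔
      q.comp g = φ := by
    rw [← GradedAlgHom.comp_assoc, gradedMap_comp_gradedMap]
    exact (hU (S ⧸ I)).1.eq_iff
  refine and_congr hφ_iff ?_
  rw [Prod.forall]
  exact forall_congr' fun j => map_eq_incl_mk_iff g (hUa j) _

end WittCoordinates

/-! ### Standard smooth homomorphisms from étale coordinates -/

section StandardSmooth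

open TensorProduct in
theorem isStandardSmoothOfRelativeDimension_mvPolynomial (R : Type*) (σ : Type) [CommRing R]
    [Finite σ] : Algebra.IsStandardSmoothOfRelativeDimension (Nat.card σ) R (MvPolynomial σ R) := by
  have hℤ : Algebra.IsStandardSmoothOfRelativeDimension (Nat.card σ) ℤ (MvPolynomial σ ℤ) := by
    have := Fintype.ofFinite σ
    let b := KaehlerDifferential.mvPolynomialBasis ℤ σ
    have : Algebra.IsStandardSmooth ℤ (MvPolynomial σ ℤ) := .of_basis_kaehlerDifferential b <| by
      rintro _ ⟨j, rfl⟩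
      exact ⟨MvPolynomial.X j, (KaehlerDifferential.mvPolynomialBasis_apply ℤ σ j).symm⟩
    rw [Algebra.IsStandardSmoothOfRelativeDimension.iff_of_isStandardSmooth, rank_eq_card_basis b]
    exact congrArg _ Nat.card_eq_fintype_card.symm
  exact .of_algEquiv _ (MvPolynomial.algebraTensorAlgEquiv ℤ R (σ := σ))

theorem FormallyEtaleAway.isStandardSmoothOfRelativeDimension {κ : Type} {R B : Type u} [Finite κ]
    [CommRing R] [IsNoetherianRing R] [CommRing B] [Algebra R B] [Algebra.FiniteType R B]
    {b : κ → B} {t : B} (h : FormallyEtaleAway (MvPolynomial.aeval (R := R) b).toRingHom t) :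
    ((algebraMap B (Localization.Away t)).comp
      (algebraMap R B)).IsStandardSmoothOfRelativeDimension (Nat.card κ) := by
  let L := Localization.Away t
  let φ : MvPolynomial κ R →+* L :=
    (algebraMap B L).comp (MvPolynomial.aeval (R := R) b).toRingHom
  have hφC : φ.comp (algebraMap R _) = (algebraMap B L).comp (algebraMap R B) := by
    rw [RingHom.comp_assoc]
    exact congrArg _ (MvPolynomial.aeval b).comp_algebraMap
  have hφ : φ.FiniteType := by
    refine .of_comp_finiteType (f := algebraMap R _) ?_
    rw [hφC, ← IsScalarTower.algebraMap_eq, RingHom.finiteType_algebraMap]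
    infer_instance
  have hφ₀ : φ.IsStandardSmoothOfRelativeDimension 0 := by
    rw [← RingHom.etale_iff_isStandardSmoothOfRelativeDimension_zero]
    let : Algebra (MvPolynomial κ R) L := φ.toAlgebra
    exact (⟨h, RingHom.FinitePresentation.of_finiteType.1 hφ⟩ : Algebra.Etale _ L)
  rw [← hφC, ← zero_add (Nat.card κ)]
  exact hφ₀.comp <| (RingHom.isStandardSmoothOfRelativeDimension_algebraMap _).2
    (isStandardSmoothOfRelativeDimension_mvPolynomial R κ)

theorem locally_of_forall_isPrime {P : ∀ {R S : Type u} [CommRing R] [CommRing S],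
    (R →+* S) → Prop} {R S : Type u} [CommRing R] [CommRing S] {φ : R →+* S}
    (h : ∀ q : Ideal S, q.IsPrime → ∃ t ∉ q, P ((algebraMap S (Localization.Away t)).comp φ)) :
    RingHom.Locally P φ := by
  refine ⟨{t | P ((algebraMap S (Localization.Away t)).comp φ)}, ?_, fun t ht => ht⟩
  by_contra hne
  obtain ⟨q, hq, hle⟩ := Ideal.exists_le_maximal _ hne
  obtain ⟨t, htq, ht⟩ := h q hq.isPrime
  exact htq (hle (Ideal.subset_span ht))

theorem FormallyEtaleAway.aeval_comp_equiv {σ κ : Type} {W B : Type u} [CommRing W] [CommRing B]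
    [Algebra W B] {b : κ → B} {t : B}
    (h : FormallyEtaleAway (MvPolynomial.aeval (R := W) b).toRingHom t) (e : σ ≃ κ) :
    FormallyEtaleAway (MvPolynomial.aeval (R := W) (b ∘ e)).toRingHom t := by
  refine formallyEtaleAway_aeval_of_existsUnique fun S _ _ I hI φ hφ s hs => ?_
  have hker : RingHom.ker (Ideal.Quotient.mkₐ W I) ^ 2 = ⊥ :=
    (congrArg (· ^ 2) (Ideal.mk_ker (I := I))).trans hI
  refine (existsUnique_congr fun ψ => and_congr_right fun _ => ?_).1
    (h.existsUnique_algHom (Ideal.Quotient.mkₐ_surjective W I) hker hφ (s := s ∘ e.symm) ?_)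
  · rw [← e.forall_congr_right]
    simp only [Function.comp_apply, Equiv.symm_apply_apply]
  · rw [← e.forall_congr_right]
    simp only [Function.comp_apply, Equiv.symm_apply_apply]
    exact hs

theorem formallyEtaleAway_aeval_relative {σ κ : Type} {W B B' : Type u} [CommRing W]
    [CommRing B] [CommRing B'] [Algebra W B] [Algebra W B'] [Algebra B B'] [IsScalarTower W B B']
    {b : σ → B} {c : κ → B'} {t : B}
    (hb : FormallyEtaleAway (MvPolynomial.aeval (R := W) b).toRingHom t)
    (hbc : FormallyEtaleAway
      (MvPolynomial.aeval (R := W) (Sum.elim (algebraMap B B' ∘ b) c)).toRingHom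
      (algebraMap B B' t)) :
    FormallyEtaleAway (MvPolynomial.aeval (R := B) c).toRingHom (algebraMap B B' t) := by
  refine formallyEtaleAway_aeval_of_existsUnique fun S _ _ I hI φ hφ s hs => ?_
  let : Algebra W S := Algebra.compHom S (algebraMap W B)
  have : IsScalarTower W B S := .of_algebraMap_eq' rfl
  have hπ : Function.Surjective (Ideal.Quotient.mkₐ W I) := Ideal.Quotient.mkₐ_surjective W I
  have hker : RingHom.ker (Ideal.Quotient.mkₐ W I) ^ 2 = ⊥ :=
    (congrArg (· ^ 2) (Ideal.mk_ker (I := I))).trans hI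
  obtain ⟨ψ, ⟨hψφ, hψ⟩, huniq⟩ := hbc.existsUnique_algHom hπ hker (φ := φ.restrictScalars W) hφ
    (s := Sum.elim (algebraMap B S ∘ b) s) (Sum.forall.2 ⟨fun x => (φ.commutes (b x)).symm, hs⟩)
  rw [Sum.forall] at hψ
  have hψB : ψ.comp (IsScalarTower.toAlgHom W B B') = IsScalarTower.toAlgHom W B S :=
    (hb.existsUnique_algHom hπ hker (φ := IsScalarTower.toAlgHom W B (S ⧸ I))
      (s := algebraMap B S ∘ b) (by rwa [φ.commutes] at hφ) fun _ => rfl).unique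
      ⟨AlgHom.ext fun x => (AlgHom.congr_fun hψφ _).trans (φ.commutes x), hψ.1⟩
      ⟨rfl, fun _ => rfl⟩
  refine ⟨{ ψ with commutes' := AlgHom.congr_fun hψB },
    ⟨AlgHom.ext fun x => AlgHom.congr_fun hψφ x, hψ.2⟩, fun δ hδ => ?_⟩
  have hδψ : δ.restrictScalars W = ψ := huniq _ ⟨AlgHom.ext fun x => AlgHom.congr_fun hδ.1 x,
    Sum.forall.2 ⟨fun x => δ.commutes (b x), hδ.2⟩⟩
  exact AlgHom.ext fun x => AlgHom.congr_fun hδψ x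

end StandardSmooth

/-! ### Smoothness of the representing algebras -/

section Smoothness

open TruncWittFrame

variable {p : ℕ} [Fact p.Prime] {n d : ℕ} {k : Type u} [Field k] [CharP k p] {A : Type u}
  [CommRing A] [Algebra (WittVector p k) A] {𝒜 : ℤ → Submodule (WittVector p k) A}
  [GradedAlgebra 𝒜] {B B' : Type u} [CommRing B] [Algebra k B] [CommRing B'] [Algebra k B']
  {U : 𝒜 →ₐᵍ[WittVector p k] grading p n k B}
  {U' : 𝒜 →ₐᵍ[WittVector p k] grading p (n + 1) k B'} {ρ : B →ₐ[k] B'}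

theorem exists_homogeneous_formallyEtaleAway (hA : RingHom.Locally
      (RingHom.IsStandardSmoothOfRelativeDimension d) (algebraMap (WittVector p k) A))
    (hn : 1 ≤ n) (U : 𝒜 →ₐᵍ[WittVector p k] grading p n k B) (q : Ideal B) [q.IsPrime] :
    ∃ (a : Fin d → A) (e : Fin d → ℤ) (f : A), (∀ j, a j ∈ 𝒜 (e j)) ∧ f ∈ 𝒜 0 ∧
      constantTerm p k B hn (U f) ∉ q ∧
      FormallyEtaleAway (MvPolynomial.aeval (R := WittVector p k) a).toRingHom f := by
  have := smooth_of_locally_isStandardSmoothOfRelativeDimension hA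
  let θ : A →+* B := (constantTerm p k B hn).comp (U : A →+* TruncWittFrame p n k B)
  have hθ (i : ℤ) (hi : i ≠ 0) (x : A) (hx : x ∈ 𝒜 i) : x ∈ q.comap θ := by
    have hx0 : θ x = 0 := constantTerm_eq_zero_of_mem hn hi (GradedFunLike.map_mem U hx)
    rw [Ideal.mem_comap, hx0]
    exact q.zero_mem
  have hrank := rankAtStalk_kaehlerDifferential hA
  obtain ⟨a, f, ha, hf, hfq, hspan⟩ := exists_homogeneous_smul_mem_span 𝒜 hθ (hrank _)
  choose e ha using ha
  refine ⟨a, e, f, ha, hf, hfq, formallyEtaleAway_aeval_of_smul_mem_span (fun q => ?_) hspan⟩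
  rw [hrank, Nat.card_fin]

theorem IsUniversal.locally_isStandardSmooth [Algebra.FiniteType k B] (hU : IsUniversal U)
    (hn : 1 ≤ n) (hA : RingHom.Locally (RingHom.IsStandardSmoothOfRelativeDimension d)
      (algebraMap (WittVector p k) A)) :
    RingHom.Locally (RingHom.IsStandardSmoothOfRelativeDimension (n * d)) (algebraMap k B) := by
  refine locally_of_forall_isPrime fun q _ => ?_
  obtain ⟨a, e, f, ha, hf, hfq, hE⟩ := exists_homogeneous_formallyEtaleAway hA hn U q
  refine ⟨_, hfq, ?_⟩
  have hcard : n * d = Nat.card (Fin d × Fin n) := by simp [mul_comm]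
  rw [hcard]
  exact (hU.formallyEtaleAway_wittCoords hn ha hf hE).isStandardSmoothOfRelativeDimension

theorem map_wittCoords_of_reduction
    (hρ : (gradedMap p n ρ).comp U = (gradedReduction p n.le_succ k B').comp U')
    {κ : Type*} (a : κ → A) (e : κ → ℤ) (j : κ) (m : Fin n) :
    ρ (wittCoords U a e (j, m)) = wittCoords U' a e (j, m.castSucc) := by
  have hj : map ρ (U (a j)) = reduction n.le_succ B' (U' (a j)) := DFunLike.congr_fun hρ (a j)
  rw [wittCoords, wittCoords, ← coeff_coord_map, hj, coord_reduction,
    TruncatedWittVector.coeff_truncate]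
  rfl

theorem map_constantTerm_of_reduction
    (hρ : (gradedMap p n ρ).comp U = (gradedReduction p n.le_succ k B').comp U')
    (hn : 1 ≤ n) (f : A) : ρ (constantTerm p k B hn (U f)) =
      constantTerm p k B' (hn.trans n.le_succ) (U' f) := by
  rw [← constantTerm_map, ← constantTerm_reduction hn n.le_succ]
  exact congrArg _ (DFunLike.congr_fun hρ f)

theorem IsUniversal.locally_isStandardSmooth_of_reduction [Algebra.FiniteType k B]
    [Algebra.FiniteType k B'] (hU : IsUniversal U) (hU' : IsUniversal U') (hn : 1 ≤ n)
    (hA : RingHom.Locally (RingHom.IsStandardSmoothOfRelativeDimension d)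
      (algebraMap (WittVector p k) A))
    (hρ : (gradedMap p n ρ).comp U = (gradedReduction p n.le_succ k B').comp U') :
    RingHom.Locally (RingHom.IsStandardSmoothOfRelativeDimension d) ρ.toRingHom := by
  let : Algebra B B' := ρ.toRingHom.toAlgebra
  have : IsScalarTower k B B' := .of_algHom ρ
  have : Algebra.FiniteType B B' := .of_restrictScalars_finiteType k B B'
  have : IsNoetherianRing B := Algebra.FiniteType.isNoetherianRing k B
  refine locally_of_forall_isPrime fun q' _ => ?_
  obtain ⟨a, e, f, ha, hf, hfq, hE⟩ :=
    exists_homogeneous_formallyEtaleAway hA (hn.trans n.le_succ) U' q'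
  refine ⟨_, hfq, ?_⟩
  let ε : (Fin d × Fin n) ⊕ (Fin d × Fin 1) ≃ Fin d × Fin (n + 1) :=
    (Equiv.prodSumDistrib (Fin d) (Fin n) (Fin 1)).symm.trans
      (Equiv.prodCongrRight fun _ => finSumFinEquiv)
  let c (x : Fin d × Fin 1) : B' := wittCoords U' a e (x.1, Fin.last n)
  have hε : wittCoords U' a e ∘ ε = Sum.elim (algebraMap B B' ∘ wittCoords U a e) c := by
    funext x
    rcases x with ⟨j, m⟩ | ⟨j, m⟩
    · exact (map_wittCoords_of_reduction hρ a e j m).symm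
    · obtain rfl := Subsingleton.elim m 0
      rfl
  have hB := hU.formallyEtaleAway_wittCoords hn ha hf hE
  have hB' := (hU'.formallyEtaleAway_wittCoords (hn.trans n.le_succ) ha hf hE).aeval_comp_equiv ε
  rw [hε, ← map_constantTerm_of_reduction hρ hn] at hB'
  rw [← map_constantTerm_of_reduction hρ hn]
  have hcard : d = Nat.card (Fin d × Fin 1) := by simp
  rw [hcard]
  exact (formallyEtaleAway_aeval_relative hB hB').isStandardSmoothOfRelativeDimension

theorem IsUniversal.comap_surjective_of_reduction [Algebra.FormallySmooth (WittVector p k) A]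
    (hU : IsUniversal U) (hU' : IsUniversal U') (hn : 1 ≤ n)
    (hρ : (gradedMap p n ρ).comp U = (gradedReduction p n.le_succ k B').comp U') :
    Function.Surjective (PrimeSpectrum.comap ρ.toRingHom) := by
  intro q
  let κ := q.asIdeal.ResidueField
  let ε : B →ₐ[k] κ := IsScalarTower.toAlgHom k B κ
  obtain ⟨ψ, hψ⟩ := exists_gradedAlgHom_comp_eq (π := gradedReduction p n.le_succ k κ)
    (reduction_surjective κ n.le_succ) (ker_reduction_sq κ hn) ((gradedMap p n ε).comp U)
  obtain ⟨γ, rfl⟩ := (hU' κ).2 ψ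
  have hγ : γ.comp ρ = ε := by
    refine (hU κ).1 (Eq.trans ?_ hψ)
    change (gradedMap p n (γ.comp ρ)).comp U =
      (gradedReduction p n.le_succ k κ).comp ((gradedMap p (n + 1) γ).comp U')
    rw [← gradedMap_comp_gradedMap, GradedAlgHom.comp_assoc, hρ, ← GradedAlgHom.comp_assoc,
      ← gradedReduction_comp_gradedMap, GradedAlgHom.comp_assoc]
  refine ⟨⟨RingHom.ker γ, RingHom.ker_isPrime _⟩, PrimeSpectrum.ext (Ideal.ext fun b => ?_)⟩
  change γ (ρ b) = 0 ↔ _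
  rw [← AlgHom.comp_apply, hγ]
  exact Ideal.algebraMap_residueField_eq_zero

end Smoothness

theorem lemma4_general (p : ℕ) [Fact p.Prime] (k : Type u) [Field k] [CharP k p]
    (A : Type u) [CommRing A] [Algebra (WittVector p k) A] [Algebra.FiniteType (WittVector p k) A]
    (𝒜 : ℤ → Submodule (WittVector p k) A) [GradedAlgebra 𝒜] (n : ℕ) (hn : 1 ≤ n) :
    (∃ B : CommAlgCat.{u} k, Algebra.FiniteType k B ∧
      Nonempty ((gradedPointsFunctor p 𝒜 n).CorepresentableBy B)) ∧
    ∀ d : ℕ,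
      SmoothOfRelativeDimension d
        (Spec.map (CommRingCat.ofHom (algebraMap (WittVector p k) A))) →
      (∀ (B : CommAlgCat.{u} k) (_ : (gradedPointsFunctor p 𝒜 n).CorepresentableBy B),
        SmoothOfRelativeDimension (n * d) (Spec.map (CommRingCat.ofHom (algebraMap k B)))) ∧
      ∀ (B B' : CommAlgCat.{u} k) (h : (gradedPointsFunctor p 𝒜 n).CorepresentableBy B)
        (h' : (gradedPointsFunctor p 𝒜 (n + 1)).CorepresentableBy B'),
        AlgebraicGeometry.Surjective (Spec.map (CommRingCat.ofHom
          (representingHom (gradedPointsReduction p 𝒜 n) h h').hom.toRingHom)) ∧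
        SmoothOfRelativeDimension d (Spec.map (CommRingCat.ofHom
          (representingHom (gradedPointsReduction p 𝒜 n) h h').hom.toRingHom)) := by
  obtain ⟨B₀, _, _, _, U, hU⟩ := exists_isUniversal (k := k) n 𝒜
  refine ⟨⟨.of k B₀, inferInstanceAs (Algebra.FiniteType k B₀), ⟨hU.corepresentableBy⟩⟩,
    fun d hd => ?_⟩
  have hA : RingHom.Locally (RingHom.IsStandardSmoothOfRelativeDimension d)
      (algebraMap (WittVector p k) A) :=
    (HasRingHomProperty.Spec_iff (P := @SmoothOfRelativeDimension d)).1 hd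
  have := smooth_of_locally_isStandardSmoothOfRelativeDimension hA
  refine ⟨fun B h => ?_, fun B B' h h' => ?_⟩
  · have := finiteType_of_corepresentableBy h
    exact (HasRingHomProperty.Spec_iff (P := @SmoothOfRelativeDimension (n * d))).2
      ((isUniversal_universalPoint h).locally_isStandardSmooth hn hA)
  · have := finiteType_of_corepresentableBy h
    have := finiteType_of_corepresentableBy h'
    have hB := isUniversal_universalPoint h
    have hB' := isUniversal_universalPoint h'
    have hρ := gradedMap_representingHom_comp_universalPoint h h'
    exact ⟨⟨hB.comap_surjective_of_reduction hB' hn hρ⟩,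
      (HasRingHomProperty.Spec_iff (P := @SmoothOfRelativeDimension d)).2
        (hB.locally_isStandardSmooth_of_reduction hB' hn hA hρ)⟩

theorem lemma4 (p : ℕ) [Fact p.Prime] (k : Type u) [Field k] [Finite k] [CharP k p]
    (A : Type u) [CommRing A] [Algebra (WittVector p k) A] [Algebra.FiniteType (WittVector p k) A]
    (𝒜 : ℤ → Submodule (WittVector p k) A) [GradedAlgebra 𝒜] (n : ℕ) (hn : 1 ≤ n) :
    (∃ B : CommAlgCat.{u} k, Algebra.FiniteType k B ∧
      Nonempty ((gradedPointsFunctor p 𝒜 n).CorepresentableBy B)) ∧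
    ∀ d : ℕ,
      SmoothOfRelativeDimension d
        (Spec.map (CommRingCat.ofHom (algebraMap (WittVector p k) A))) →
      (∀ (B : CommAlgCat.{u} k) (_ : (gradedPointsFunctor p 𝒜 n).CorepresentableBy B),
        SmoothOfRelativeDimension (n * d) (Spec.map (CommRingCat.ofHom (algebraMap k B)))) ∧
      ∀ (B B' : CommAlgCat.{u} k) (h : (gradedPointsFunctor p 𝒜 n).CorepresentableBy B)
        (h' : (gradedPointsFunctor p 𝒜 (n + 1)).CorepresentableBy B'),
        AlgebraicGeometry.Surjective (Spec.map (CommRingCat.ofHom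
          (representingHom (gradedPointsReduction p 𝒜 n) h h').hom.toRingHom)) ∧
        SmoothOfRelativeDimension d (Spec.map (CommRingCat.ofHom
          (representingHom (gradedPointsReduction p 𝒜 n) h h').hom.toRingHom)) :=
  lemma4_general p k A 𝒜 n hn
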